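/- Let $p$ be a prime, $G$ a finite group, and $\mathcal{A}$ the collection of all $p$-subgroups of $G$ (including the trivial subgroup). *Mackey functors.* Let $\omega(G)$ be the category whose objects are the finite $G$-sets and whose morphisms $S\to T$ are the isomorphism classes of spans $S\leftarrow V\to T$ of finite $G$-sets, composed by fibre product. A Mackey functor $\Gamma$ for $G$ is a functor from $\omega(G)$ to abelian groups that takes (finite) coproducts to coproducts. It is $p$-constrained if, for every map $S\to T$ of finite $G$-sets all of whose fibres have cardinality prime to $p$, the morphism $T\leftarrow S\to T$ of $\omega(G)$ induces an isomorphism on $\Gamma(T)$. A map $f\colon S\to T$ of finite $G$-sets gives rise to the morphisms $S\xleftarrow{=}S\xrightarrow{f}T$ and $T\xleftarrow{f}S\xrightarrow{=}S$, so $\Gamma$ restricts to a covariant functor $\gamma$ and a contravariant functor $\gamma^\natural$ on finite $G$-sets; these are extended to all $G$-sets so that $\gamma$ takes disjoint unions to direct sums and $\gamma^\natural$ takes disjoint unions to products. *Bredon homology and cohomology.* A $G$-space is a simplicial $G$-set. For a $G$-space $X$, the Bredon homology $H^{\mathrm{Br}}_*(X;\Gamma)$ is the homology of the normalized chain complex of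 the simplicial abelian group $n\mapsto\gamma(X_n)$, and the Bredon cohomology $H_{\mathrm{Br}}^*(X;\Gamma)$ is the cohomology of the normalized cochain complex of the cosimplicial abelian group $n\mapsto\gamma^\natural(X_n)$. *Approximations.* An $\mathcal{A}$-approximation to a $G$-space $X$ is a map of $G$-spaces $X_{\mathcal{A}}\to X$ such that the isotropy subgroup of every simplex of $X_{\mathcal{A}}$ lies in $\mathcal{A}$ and $(X_{\mathcal{A}})^K\to X^K$ is a weak homotopy equivalence for every $K\in\mathcal{A}$. **Proposition.** Let $\Gamma$ be a $p$-constrained Mackey functor for $G$. Then for any $G$-space $X$, every $\mathcal{A}$-approximation $X_{\mathcal{A}}\to X$ induces isomorphisms $H^{\mathrm{Br}}_n(X_{\mathcal{A}};\Gamma)\to H^{\mathrm{Br}}_n(X;\Gamma)$ and $H_{\mathrm{Br}}^n(X;\Gamma)\to H_{\mathrm{Br}}^n(X_{\mathcal{A}};\Gamma)$ for all $n\ge 0$. -/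

import Mathlib

open CategoryTheory CategoryTheory.Limits Opposite

universe u v w

namespace Bredon

/-! ### The span category -/

/-- Isomorphism classes of spans `S ⟵ V ⟶ T` in a category `C`. -/
abbrev SpanClass {C : Type v} [Category.{w} C] (S T : C) : Type (max v w) :=
  Quotient (isIsomorphicSetoid (Span (⊤ : MorphismProperty C) (⊤ : MorphismProperty C) S T))

/-- The class of the span `S ⟵ V ⟶ T` with legs `l` and `r`. -/
def spanClass {C : Type v} [Category.{w} C] {S T V : C} (l : V ⟶ S) (r : V ⟶ T) :
    SpanClass S T :=
  Quotient.mk _ ⟨V, l, r, trivial, trivial⟩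

/-- Two spans have the same class if there is an isomorphism of apices over both ends. -/
theorem spanClass_eq {C : Type v} [Category.{w} C] {S T V V' : C} {l : V ⟶ S} {r : V ⟶ T}
    {l' : V' ⟶ S} {r' : V' ⟶ T} (e : V ≅ V') (hl : e.hom ≫ l' = l) (hr : e.hom ≫ r' = r) :
    spanClass l r = spanClass l' r' :=
  Quotient.sound ⟨Span.mkIso e hl hr⟩

/-- Composition of classes of spans, by fibre product. -/
noncomputable def SpanClass.comp {C : Type v} [Category.{w} C] [HasPullbacks C] {S T R : C}
    (a : SpanClass S T) (b : SpanClass T R) : SpanClass S R :=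
  Quotient.map₂ (fun s t => Span.comp s t)
    (by
      rintro s s' ⟨e⟩ t t' ⟨f⟩
      have e1 : e.hom.hom ≫ s'.r = s.r := e.hom.hom_r
      have f1 : f.hom.hom ≫ t'.l = t.l := f.hom.hom_l
      have ee : IsIso e.hom.hom := ⟨e.inv.hom, congrArg Span.Hom.hom e.hom_inv_id,
        congrArg Span.Hom.hom e.inv_hom_id⟩
      have ff : IsIso f.hom.hom := ⟨f.inv.hom, congrArg Span.Hom.hom f.hom_inv_id,
        congrArg Span.Hom.hom f.inv_hom_id⟩
      have hP : IsPullback (pullback.fst s.r t.l ≫ e.hom.hom) (pullback.snd s.r t.l ≫ f.hom.hom)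
          s'.r t'.l :=
        (IsPullback.of_hasPullback s.r t.l).of_iso (Iso.refl _) (asIso e.hom.hom)
          (asIso f.hom.hom) (Iso.refl _) (by simp) (by simp) (by simp [e1]) (by simp [f1])
      refine ⟨Span.mkIso hP.isoPullback ?_ ?_⟩
      · exact (hP.isoPullback_hom_fst_assoc _).trans
          ((Category.assoc _ _ _).trans (congrArg _ e.hom.hom_l))
      · exact (hP.isoPullback_hom_snd_assoc _).trans
          ((Category.assoc _ _ _).trans (congrArg _ f.hom.hom_r))) a b

theorem SpanClass.comp_spanClass {C : Type v} [Category.{w} C] [HasPullbacks C] {S T R V W : C}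
    (l : V ⟶ S) (r : V ⟶ T) (l' : W ⟶ T) (r' : W ⟶ R) :
    (spanClass l r).comp (spanClass l' r') =
      spanClass (pullback.fst r l' ≫ l) (pullback.snd r l' ≫ r') := rfl

/-- Any pullback square may be used to compute a composite of spans. -/
theorem SpanClass.comp_eq_of_isPullback {C : Type v} [Category.{w} C] [HasPullbacks C]
    {S T R V W P : C} {l : V ⟶ S} {r : V ⟶ T} {l' : W ⟶ T} {r' : W ⟶ R}
    {p : P ⟶ V} {q : P ⟶ W} (h : IsPullback p q r l') :
    (spanClass l r).comp (spanClass l' r') = spanClass (p ≫ l) (q ≫ r') := by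
  rw [SpanClass.comp_spanClass]
  exact spanClass_eq h.isoPullback.symm (by simp) (by simp)

/-- The category whose objects are those of `C` and whose morphisms are isomorphism classes of
spans. -/
structure SpanCat (C : Type v) where
  /-- The underlying object. -/
  obj : C

noncomputable instance {C : Type v} [Category.{w} C] [HasPullbacks C] :
    Category.{max v w} (SpanCat C) where
  Hom S T := SpanClass S.obj T.obj
  id S := spanClass (𝟙 S.obj) (𝟙 S.obj)
  comp a b := a.comp b
  id_comp := by
    rintro S T ⟨s⟩
    exact (SpanClass.comp_eq_of_isPullback (IsPullback.of_id_snd (f := s.l))).trans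
      (spanClass_eq (Iso.refl _) (by simp) (by simp))
  comp_id := by
    rintro S T ⟨s⟩
    exact (SpanClass.comp_eq_of_isPullback (IsPullback.of_id_fst (f := s.r))).trans
      (spanClass_eq (Iso.refl _) (by simp) (by simp))
  assoc := by
    rintro S T R Q ⟨s⟩ ⟨t⟩ ⟨r⟩
    have h1 := IsPullback.of_hasPullback s.r t.l
    have h2 := IsPullback.of_hasPullback t.r r.l
    have h3 := IsPullback.of_hasPullback (pullback.snd s.r t.l) (pullback.fst t.r r.l)
    have e1 := SpanClass.comp_eq_of_isPullback (l := pullback.fst s.r t.l ≫ s.l) (r' := r.r)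
      (h3.paste_vert h2)
    have e2 := SpanClass.comp_eq_of_isPullback (l := s.l) (r' := pullback.snd t.r r.l ≫ r.r)
      (h3.paste_horiz h1)
    refine e1.trans ((spanClass_eq (Iso.refl _) ?_ ?_).trans e2.symm)
    · simp
    · simp

namespace SpanCat

/-- The covariant embedding `(f : S ⟶ T) ↦ (S ⟵ S ⟶ T)`. -/
noncomputable def covariant (C : Type v) [Category.{w} C] [HasPullbacks C] : C ⥤ SpanCat C where
  obj S := ⟨S⟩
  map {S _} f := spanClass (𝟙 S) f
  map_id _ := rfl
  map_comp {S T _} f g :=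
    ((SpanClass.comp_eq_of_isPullback (IsPullback.of_id_fst (f := f))).trans
      (spanClass_eq (Iso.refl _) (by simp) (by simp))).symm

/-- The contravariant embedding `(f : S ⟶ T) ↦ (T ⟵ S ⟶ S)`. -/
noncomputable def contravariant (C : Type v) [Category.{w} C] [HasPullbacks C] :
    Cᵒᵖ ⥤ SpanCat C where
  obj S := ⟨S.unop⟩
  map {_ T} f := spanClass f.unop (𝟙 T.unop)
  map_id _ := rfl
  map_comp {S T _} f g :=
    ((SpanClass.comp_eq_of_isPullback (IsPullback.of_id_snd (f := g.unop))).trans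
      (spanClass_eq (Iso.refl _) (by simp) (by simp))).symm

end SpanCat

/-! ### `G`-sets, finite `G`-sets, Mackey functors -/

/-- The category of `G`-sets. -/
abbrev GSet (G : Type u) [Group G] := Action (Type u) G

/-- The category of finite `G`-sets. -/
abbrev FinGSet (G : Type u) [Group G] := Action FintypeCat.{u} G

/-- The category `ω(G)`: finite `G`-sets, and isomorphism classes of spans of finite `G`-sets. -/
abbrev Omega (G : Type u) [Group G] := SpanCat (FinGSet G)

/-- A Mackey functor for `G`: a functor from `ω(G)` to abelian groups which takes (finite)
coproducts in `ω(G)` to coproducts of abelian groups. -/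
structure MackeyFunctor (G : Type u) [Group G] where
  /-- The underlying functor. -/
  functor : Omega G ⥤ AddCommGrpCat.{u}
  additive : PreservesFiniteCoproducts functor

namespace MackeyFunctor

variable {G : Type u} [Group G] (Γ : MackeyFunctor G)

/-- The covariant functor `γ` on finite `G`-sets underlying a Mackey functor. -/
noncomputable def cov : FinGSet G ⥤ AddCommGrpCat.{u} :=
  SpanCat.covariant (FinGSet G) ⋙ Γ.functor

/-- The contravariant functor `γ♮` on finite `G`-sets underlying a Mackey functor. -/
noncomputable def contra : (FinGSet G)ᵒᵖ ⥤ AddCommGrpCat.{u} :=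
  SpanCat.contravariant (FinGSet G) ⋙ Γ.functor

/-- `Γ` is `p`-constrained: for any map `f : S ⟶ T` of finite `G`-sets all of whose fibres have
cardinality prime to `p`, the morphism `T ⟵ S ⟶ T` of `ω(G)` induces an isomorphism on `Γ(T)`. -/
def IsPConstrained (p : ℕ) : Prop :=
  ∀ ⦃S T : FinGSet G⦄ (f : S ⟶ T),
    (∀ t : T.V, (Nat.card {s : S.V // f.hom s = t}).Coprime p) →
      IsIso (Γ.functor.map (X := ⟨T⟩) (Y := ⟨T⟩) (spanClass f f))

end MackeyFunctor

/-! ### Extension of coefficient functors from finite `G`-sets to all `G`-sets -/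

section Extension

variable {G : Type u} [Group G]

/-- Two elements of a `G`-set are related if they lie in the same orbit. -/
def orbitSetoid (S : GSet G) : Setoid S.V where
  r x y := ∃ g : G, S.ρ g x = y
  iseqv :=
    { refl := fun x => ⟨1, by simp⟩
      symm := by
        rintro x y ⟨g, rfl⟩
        exact ⟨g⁻¹, by simp⟩
      trans := by
        rintro x y z ⟨g, rfl⟩ ⟨h, rfl⟩
        exact ⟨h * g, by simp [End.mul_def]⟩ }

/-- The set of orbits of a `G`-set. -/
abbrev Orbits (S : GSet G) : Type u := Quotient (orbitSetoid S)

/-- The map on sets of orbits induced by a map of `G`-sets. -/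
def mapOrbits {S T : GSet G} (f : S ⟶ T) : Orbits S → Orbits T :=
  Quotient.map f.hom (by
    rintro x y ⟨g, rfl⟩
    exact ⟨g, (ConcreteCategory.congr_hom (f.comm g) x).symm⟩)

theorem mk_rho (S : GSet G) (g : G) (x : S.V) :
    Quotient.mk (orbitSetoid S) (S.ρ g x) = Quotient.mk (orbitSetoid S) x :=
  (Quotient.sound ⟨g, rfl⟩ : Quotient.mk (orbitSetoid S) x = _).symm

/-- The elements of an orbit. -/
abbrev OrbitElts {S : GSet G} (o : Orbits S) : Type u :=
  {x : S.V // Quotient.mk (orbitSetoid S) x = o}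

theorem finite_orbitElts [Finite G] {S : GSet G} (o : Orbits S) : Finite (OrbitElts o) := by
  obtain ⟨x, rfl⟩ := Quotient.exists_rep o
  refine Finite.of_surjective
    (fun g : G => (⟨S.ρ g x, mk_rho S g x⟩ : OrbitElts (Quotient.mk (orbitSetoid S) x))) ?_
  rintro ⟨y, hy⟩
  obtain ⟨g, hg⟩ := Quotient.exact hy.symm
  exact ⟨g, Subtype.ext hg⟩

/-- An orbit of a `G`-set, as a finite `G`-set. -/
def orbit [Finite G] {S : GSet G} (o : Orbits S) : FinGSet G where
  V := ⟨OrbitElts o, finite_orbitElts o⟩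
  ρ :=
    { toFun := fun g =>
        FintypeCat.homMk fun x : OrbitElts o => ⟨S.ρ g x.1, (mk_rho S g x.1).trans x.2⟩
      map_one' := FintypeCat.hom_ext _ _ fun x => Subtype.ext (by
        change S.ρ 1 x.1 = x.1
        simp)
      map_mul' := fun g h => FintypeCat.hom_ext _ _ fun x => Subtype.ext (by
        change S.ρ (g * h) x.1 = S.ρ g (S.ρ h x.1)
        simp [End.mul_def]) }

/-- The restriction of a map of `G`-sets to an orbit of the source and its image orbit. -/
def orbitMap [Finite G] {S T : GSet G} (f : S ⟶ T) (o : Orbits S) (o' : Orbits T)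
    (h : mapOrbits f o = o') : orbit o ⟶ orbit o' where
  hom := FintypeCat.homMk fun x : OrbitElts o =>
    (⟨f.hom x.1, (congrArg (mapOrbits f) x.2).trans h⟩ : OrbitElts o')
  comm g := FintypeCat.hom_ext _ _ fun x => Subtype.ext <| by
    have h1 : f.hom (S.ρ g x.1) = T.ρ g (f.hom x.1) :=
      ConcreteCategory.congr_hom (f.comm g) x.1
    exact h1

variable {C : Type v} [Category.{w} C] [HasCoproducts.{u} C]

theorem map_orbitMap_comp_ι [Finite G] (F : FinGSet G ⥤ C) {S T : GSet G} (f : S ⟶ T)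
    (o : Orbits S) (o' : Orbits T) (h : mapOrbits f o = o') :
    F.map (orbitMap f o (mapOrbits f o) rfl) ≫
        Sigma.ι (fun q : Orbits T => F.obj (orbit q)) (mapOrbits f o) =
      F.map (orbitMap f o o' h) ≫ Sigma.ι (fun q : Orbits T => F.obj (orbit q)) o' := by
  subst h
  rfl

/-- The extension of a functor `F` from finite (or transitive) `G`-sets to all `G`-sets which takes
disjoint unions to coproducts: `S` is sent to the coproduct of the `F(o)`, where `o` runs over
the orbits of `S`. -/
noncomputable def additiveExtension [Finite G] (F : FinGSet G ⥤ C) : GSet G ⥤ C where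
  obj S := ∐ fun o : Orbits S => F.obj (orbit o)
  map {_ T} f := Sigma.desc fun o =>
    F.map (orbitMap f o (mapOrbits f o) rfl) ≫
      Sigma.ι (fun q : Orbits T => F.obj (orbit q)) (mapOrbits f o)
  map_id S := by
    apply Sigma.hom_ext
    intro o
    have h : mapOrbits (𝟙 S) o = o := by
      obtain ⟨x, rfl⟩ := Quotient.exists_rep o
      rfl
    have h1 : orbitMap (𝟙 S) o o h = 𝟙 (orbit o) := rfl
    rw [Sigma.ι_desc, map_orbitMap_comp_ι F (𝟙 S) o o h, h1]
    simp
  map_comp {S T R} f g := by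
    apply Sigma.hom_ext
    intro o
    have h : mapOrbits (f ≫ g) o = mapOrbits g (mapOrbits f o) := by
      obtain ⟨x, rfl⟩ := Quotient.exists_rep o
      rfl
    have h1 : orbitMap (f ≫ g) o _ h =
        orbitMap f o _ rfl ≫ orbitMap g (mapOrbits f o) _ rfl := rfl
    rw [Sigma.ι_desc, map_orbitMap_comp_ι F (f ≫ g) o _ h, h1]
    simp

end Extension

/-! ### `G`-spaces, Bredon homology and cohomology -/

/-- A `G`-space: a simplicial `G`-set, i.e. a simplicial set with an action of `G`. -/
abbrev GSpace (G : Type u) [Group G] := SimplicialObject (GSet G)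

section BredonHomology

variable {G : Type u} [Group G] [Finite G]

/-- Apply the extension to all `G`-sets of the coefficient functor `F` degreewise to a `G`-space,
and normalize the resulting simplicial object. -/
noncomputable def normalizedChains {C : Type v} [Category.{w} C] [Abelian C] [HasCoproducts.{u} C]
    (F : FinGSet G ⥤ C) : GSpace G ⥤ ChainComplex C ℕ :=
  (SimplicialObject.whiskering (GSet G) C).obj (additiveExtension F) ⋙
    AlgebraicTopology.normalizedMooreComplex C

/-- The Bredon chains with coefficients in a covariant functor `γ`. -/
noncomputable def bredonChains (γ : FinGSet G ⥤ AddCommGrpCat.{u}) :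
    GSpace G ⥤ ChainComplex AddCommGrpCat.{u} ℕ :=
  normalizedChains γ

/-- The Bredon cochains with coefficients in a contravariant functor `γ♮`. A cosimplicial abelian
group is the same thing as a simplicial object in the opposite of the category of abelian groups,
and coproducts in this opposite category are products of abelian groups. Thus the cosimplicial
abelian group at hand is `A^n = ∏ γ♮(o)`, over the orbits `o` of `X_n`, and normalizing it in the
opposite category gives the cochain complex whose term in degree `n` is the quotient of `A^n` by
the sum of the images of the cofaces `d^1, …, d^n`, with differential induced by `d^0`. -/
noncomputable def bredonCochains (γ : (FinGSet G)ᵒᵖ ⥤ AddCommGrpCat.{u}) :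
    (GSpace G)ᵒᵖ ⥤ HomologicalComplex AddCommGrpCat.{u} (ComplexShape.down ℕ).symm :=
  (normalizedChains γ.rightOp).op ⋙ HomologicalComplex.unopFunctor _ _

/-- Bredon homology `H_n(X; Γ)`, as a functor of the `G`-space `X`. -/
noncomputable def bredonHomology (Γ : MackeyFunctor G) (n : ℕ) : GSpace G ⥤ AddCommGrpCat.{u} :=
  bredonChains Γ.cov ⋙ HomologicalComplex.homologyFunctor _ _ n

/-- Bredon cohomology `H^n(X; Γ)`, as a contravariant functor of the `G`-space `X`. -/
noncomputable def bredonCohomology (Γ : MackeyFunctor G) (n : ℕ) :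
    (GSpace G)ᵒᵖ ⥤ AddCommGrpCat.{u} :=
  bredonCochains Γ.contra ⋙ HomologicalComplex.homologyFunctor _ _ n

end BredonHomology

/-! ### Fixed points, isotropy and approximations -/

section Approximation

/-- The set `[X, Z]` of simplicial homotopy classes of maps (for the equivalence relation
generated by homotopy; if `Z` is a Kan complex, homotopy is an equivalence relation). -/
abbrev HomotopyClasses (X Z : SSet.{u}) : Type u :=
  Quot fun f g : X ⟶ Z => Nonempty (SSet.Homotopy f g)

/-- The map `[Y, Z] → [X, Z]` given by composition with `f : X ⟶ Y`. -/
def precompHomotopyClasses {X Y : SSet.{u}} (f : X ⟶ Y) (Z : SSet.{u}) :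
    HomotopyClasses Y Z → HomotopyClasses X Z :=
  Quot.map (fun g => f ≫ g) (by
    rintro g g' ⟨h⟩
    have h' : SSet.Homotopy (f ≫ g) (f ≫ g') :=
      h.precomp (SSet.RelativeMorphism.botEquiv.symm f) (SSet.Subcomplex.isInitialBot.hom_ext _ _)
    exact ⟨h'⟩)

/-- A map `f : X ⟶ Y` of simplicial sets is a (weak homotopy) equivalence if it induces a bijection
`[Y, Z] → [X, Z]` on homotopy classes for every Kan complex `Z`. -/
def IsWeakEquivalence {X Y : SSet.{u}} (f : X ⟶ Y) : Prop :=
  ∀ (Z : SSet.{u}) [SSet.KanComplex Z], Function.Bijective (precompHomotopyClasses f Z)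

variable {G : Type u} [Group G]

/-- The functor `S ↦ S^K` of fixed points on `G`-sets. -/
def fixedPointsFunctor (K : Subgroup G) : GSet G ⥤ Type u where
  obj S := {x : S.V // ∀ g ∈ K, S.ρ g x = x}
  map {S T} f := ↾fun x => ⟨f.hom x.1, fun g hg => by
    have h1 : f.hom (S.ρ g x.1) = T.ρ g (f.hom x.1) :=
      ConcreteCategory.congr_hom (f.comm g) x.1
    rw [← h1, x.2 g hg]⟩

/-- The fixed point space functor `X ↦ X^K` on `G`-spaces. -/
def fixedPoints (K : Subgroup G) : GSpace G ⥤ SSet.{u} :=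
  (SimplicialObject.whiskering (GSet G) (Type u)).obj (fixedPointsFunctor K)

/-- The isotropy subgroup of an element of a `G`-set. -/
def isotropy (S : GSet G) (x : S.V) : Subgroup G where
  carrier := {g | S.ρ g x = x}
  one_mem' := by simp
  mul_mem' {a b} (ha : S.ρ a x = x) (hb : S.ρ b x = x) := by
    simp [End.mul_def, ha, hb]
  inv_mem' {a} (ha : S.ρ a x = x) := by
    have h : S.ρ a⁻¹ (S.ρ a x) = x := by simp
    rwa [ha] at h

/-- The set `Iso(X)` of all isotropy subgroups of simplices of a `G`-space. -/
def isotropySubgroups (X : GSpace G) : Set (Subgroup G) :=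
  {K | ∃ (n : SimplexCategoryᵒᵖ) (x : (X.obj n).V), isotropy (X.obj n) x = K}

variable (G) in
/-- A collection of subgroups of `G`: a set of subgroups which is closed under conjugation. -/
structure SubgroupCollection where
  /-- The underlying set of subgroups. -/
  carrier : Set (Subgroup G)
  conj_mem : ∀ K ∈ carrier, ∀ g : G, K.map (MulAut.conj g).toMonoidHom ∈ carrier

variable (G) in
/-- The collection of all `p`-subgroups of `G`. -/
def allPSubgroups (p : ℕ) : SubgroupCollection G where
  carrier := {K | IsPGroup p K}
  conj_mem _ hK _ := hK.map _

/-- A map `f : Y ⟶ X` of `G`-spaces is a `𝒞`-approximation to `X` if `Y` has `𝒞`-isotropy and `f`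
is a `𝒞`-equivalence. -/
structure IsApproximation (𝒞 : SubgroupCollection G) {Y X : GSpace G} (f : Y ⟶ X) : Prop where
  isotropy_subset : isotropySubgroups Y ⊆ 𝒞.carrier
  equivalence : ∀ K ∈ 𝒞.carrier, IsWeakEquivalence ((fixedPoints K).map f)

end Approximation

end Bredon

/-!
# Approximations for `p`-constrained Mackey functors

Let `P` be a Sylow `p`-subgroup of `G`, and let `U = G / P`, a finite `G`-set of cardinality prime
to `p` whose isotropy groups are `p`-groups.

If `Γ` is `p`-constrained, then for every finite `G`-set `T` the composite of the transfer
`Γ(T) ⟶ Γ(T × U)` with the map `Γ(T × U) ⟶ Γ(T)` induced by the projection is invertible. Both maps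
are natural in `T` for the covariant functoriality, the first one by the double coset formula, and
they extend to all `G`-sets. Hence the coefficient functor `S ↦ γ(S)` is a direct summand of
`S ↦ γ(S × U)` (`extensionRetract`), and it suffices to prove that an approximation `Y ⟶ X` gives
rise to a homotopy equivalence on chains with coefficients in the latter.

The orbits of `S × U` are transitive `G`-sets over `U`, so their isotropy groups are `p`-groups.
Consider the presheaf `A ↦ ℤ[Hom(A, S)]` on the category of transitive finite `G`-sets over `U`, the
*linearization* of `S`. It is the direct sum of the free presheaves represented by the orbits of
`S × U` (`orbitValues_bijective`). This has two consequences. The linearization is projective; and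
the functor `S ↦ γ(S × U)` extends to an additive functor from linearizations to abelian groups
(`realization`). On the other hand, at `A = G / K`, the chains on the linearization of a `G`-space
`X` are the ordinary chains on `X^K`. As `Y^K ⟶ X^K` is a weak equivalence, it is a homology
isomorphism (`quasiIso_of_isWeakEquivalence`), so `Y ⟶ X` induces a quasi-isomorphism between
nonnegative complexes of projective presheaves, which is therefore a homotopy equivalence. The
additive functor above turns it into the homotopy equivalence that is wanted
(`homotopyEquivalences_prodExtension`).

All this applies to coefficients in any preadditive category with coproducts. Cohomology is the case
of the opposite of the category of abelian groups, where the roles of the transfers and of the maps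
induced by projections are interchanged.

That a Mackey functor takes a finite `G`-set to the direct sum of its values at the orbits, for both
functorialities, holds because disjoint unions are coproducts in the category of spans
(`isColimitCovariantCofan`), and even biproducts after applying the Mackey functor
(`nonempty_isLimit_contravariant_fan`).
-/

namespace Bredon

/-! ### Simplicial abelian groups are Kan complexes -/

section Kan

open Simplicial SimplexCategory

variable (A : SimplicialObject AddCommGrpCat.{u})

/-- If the prescribed face `xm` is compatible with the `j`-th face of `w`, then the error
`xm - d_m w` of `w` at `m` has vanishing `j`-th face (`j` below `m` in the first statement, and
above `m` in the second one). Hence correcting `w` by a degeneracy of this error does not disturb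
the faces which are right already. -/
theorem filler_error_eq_zero {n : ℕ} {m : Fin (n + 3)} (xm : A _⦋n + 1⦌) (w : A _⦋n + 2⦌) :
    (∀ (j : Fin (n + 2)) (k : Fin (n + 2)), j ≤ k → m = k.succ →
      A.δ j xm = A.δ k (A.δ j.castSucc w) → A.δ j (xm - A.δ m w) = 0) ∧
    (∀ (j : Fin (n + 2)) (k : Fin (n + 2)), k ≤ j → m = k.castSucc →
      A.δ j xm = A.δ k (A.δ j.succ w) → A.δ j (xm - A.δ m w) = 0) := by
  refine ⟨?_, ?_⟩
  · rintro j k hjk rfl h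
    have := ConcreteCategory.congr_hom (A.δ_comp_δ hjk) w
    simp only [ConcreteCategory.comp_apply] at this
    rw [map_sub, h, this, sub_self]
  · rintro j k hjk rfl h
    have := ConcreteCategory.congr_hom (A.δ_comp_δ hjk) w
    simp only [ConcreteCategory.comp_apply] at this
    rw [map_sub, h, this, sub_self]

/-- Moore's horn filling: compatible elements `x j`, for `j ≠ i`, are the faces of some `w`. The
faces below `i` are corrected in increasing order, by the degeneracies `s_m`, and then the faces
above `i` in decreasing order, by the degeneracies `s_(m-1)`. -/
theorem exists_horn_filler {n : ℕ} (i : Fin (n + 3)) (x : Fin (n + 3) → A _⦋n + 1⦌)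
    (hx : ∀ j k : Fin (n + 2), j ≤ k → j.castSucc ≠ i → k.succ ≠ i →
      A.δ k (x j.castSucc) = A.δ j (x k.succ)) :
    ∃ w : A _⦋n + 2⦌, ∀ j, j ≠ i → A.δ j w = x j := by
  have up : ∀ m : ℕ, m ≤ i.val →
      ∃ w : A _⦋n + 2⦌, ∀ j : Fin (n + 3), j.val < m → A.δ j w = x j := by
    intro m
    induction m with
    | zero => exact fun _ => ⟨0, fun j hj => absurd hj (by simp)⟩
    | succ m ih =>
      intro hm
      obtain ⟨w, hw⟩ := ih (by omega)
      let c : Fin (n + 2) := ⟨m, by omega⟩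
      refine ⟨w + A.σ c (x c.castSucc - A.δ c.castSucc w), fun j hj => ?_⟩
      rcases Nat.lt_succ_iff_lt_or_eq.mp hj with hj | hj
      · obtain ⟨c', hc'⟩ : ∃ c' : Fin (n + 1), c = c'.succ :=
          ⟨⟨m - 1, by omega⟩, Fin.ext (by simp [c]; omega)⟩
        obtain ⟨j', rfl⟩ : ∃ j' : Fin (n + 2), j = j'.castSucc :=
          ⟨⟨j, by omega⟩, rfl⟩
        have hjc : j' ≤ c'.castSucc := by
          have := congrArg Fin.val hc'
          simp [c] at this
          simp [Fin.le_def] at hj ⊢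
          omega
        have h1 := ConcreteCategory.congr_hom (A.δ_comp_σ_of_le hjc)
          (x c.castSucc - A.δ c.castSucc w)
        simp only [ConcreteCategory.comp_apply] at h1
        have h0 : A.δ j' (x c.castSucc - A.δ c.castSucc w) = 0 := by
          refine (filler_error_eq_zero A _ w).1 j' c'.castSucc hjc (by rw [hc']; rfl) ?_
          rw [hw _ hj, hx j' c'.castSucc hjc (fun h => ?_) (fun h => ?_), hc']
          · rfl
          · rw [← h] at hm
            simp at hm hj
            omega
          · have := congrArg Fin.val hc'
            rw [← h] at hm
            simp [c] at this hm
            omega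
        rw [← hc', h0, map_zero] at h1
        rw [map_add, hw _ hj, h1, add_zero]
      · obtain rfl : j = c.castSucc := Fin.ext hj
        have h1 := ConcreteCategory.congr_hom (A.δ_comp_σ_self (i := c))
          (x c.castSucc - A.δ c.castSucc w)
        simp only [ConcreteCategory.comp_apply] at h1
        rw [map_add, h1]
        simp
  -- The faces that are right after `m` steps are those below `i` and the `m` highest ones.
  have down : ∀ m : ℕ, m + i.val ≤ n + 2 → ∃ w : A _⦋n + 2⦌, ∀ j : Fin (n + 3),
      j.val < i.val ∨ n + 2 < m + j.val → A.δ j w = x j := by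
    intro m
    induction m with
    | zero =>
      intro _
      obtain ⟨w, hw⟩ := up i.val le_rfl
      exact ⟨w, fun j hj => hw j (by omega)⟩
    | succ m ih =>
      intro hm
      obtain ⟨w, hw⟩ := ih (by omega)
      let c : Fin (n + 2) := ⟨n + 1 - m, by omega⟩
      refine ⟨w + A.σ c (x c.succ - A.δ c.succ w), fun j hj => ?_⟩
      rcases (show j.val < i.val ∨ n + 2 < m + j.val ∨ j.val = n + 2 - m by omega) with hj | hj | hj
      · obtain ⟨c', hc'⟩ : ∃ c' : Fin (n + 1), c = c'.succ :=
          ⟨⟨n - m, by omega⟩, Fin.ext (by simp [c]; omega)⟩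
        obtain ⟨j', rfl⟩ : ∃ j' : Fin (n + 2), j = j'.castSucc :=
          ⟨⟨j, by omega⟩, rfl⟩
        have hv := congrArg Fin.val hc'
        simp [c] at hv hj
        have hjc : j' ≤ c'.castSucc := by
          simp [Fin.le_def]
          omega
        have hjc2 : j' ≤ c := by
          simp [Fin.le_def, c]
          omega
        have h1 := ConcreteCategory.congr_hom (A.δ_comp_σ_of_le hjc) (x c.succ - A.δ c.succ w)
        simp only [ConcreteCategory.comp_apply] at h1
        have h0 : A.δ j' (x c.succ - A.δ c.succ w) = 0 := by
          refine (filler_error_eq_zero A _ w).1 j' c hjc2 rfl ?_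
          rw [hw _ (Or.inl hj), hx j' c hjc2 (fun h => ?_) (fun h => ?_)]
          · rw [← h] at hj
            simp at hj
          · rw [← h] at hm
            simp [c] at hm
            omega
        rw [← hc', h0, map_zero] at h1
        rw [map_add, hw _ (Or.inl hj), h1, add_zero]
      · obtain ⟨j', rfl⟩ : ∃ j' : Fin (n + 2), j = j'.succ :=
          ⟨⟨j - 1, by omega⟩, Fin.ext (by simp; omega)⟩
        obtain ⟨c', hc'⟩ : ∃ c' : Fin (n + 1), c = c'.castSucc :=
          ⟨⟨n + 1 - m, by simp at hj; omega⟩, Fin.ext (by simp [c])⟩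
        have hv := congrArg Fin.val hc'
        simp [c] at hv hj
        have hjc : c'.castSucc < j' := by
          simp [Fin.lt_def]
          omega
        have h1 := ConcreteCategory.congr_hom (A.δ_comp_σ_of_gt hjc) (x c.succ - A.δ c.succ w)
        simp only [ConcreteCategory.comp_apply] at h1
        have hj2 : j'.val < i.val ∨ n + 2 < m + j'.succ.val := by simp; omega
        have h0 : A.δ j' (x c.succ - A.δ c.succ w) = 0 := by
          have hjc3 : c'.succ ≤ j' := by simpa [Fin.le_def, Fin.lt_def] using! hjc
          refine (filler_error_eq_zero A _ w).2 j' c'.succ hjc3 (by rw [hc']; rfl) ?_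
          rw [hw _ (by simp; omega), ← hx c'.succ j' hjc3 (fun h => ?_) (fun h => ?_), hc']
          · rfl
          · rw [← h] at hm
            simp at hm
            omega
          · rw [← h] at hm
            simp at hm
            omega
        rw [← hc', h0, map_zero] at h1
        rw [map_add, hw _ (by simp; omega), h1, add_zero]
      · obtain rfl : j = c.succ := Fin.ext (by simp [c]; omega)
        have h1 := ConcreteCategory.congr_hom (A.δ_comp_σ_succ (i := c))
          (x c.succ - A.δ c.succ w)
        simp only [ConcreteCategory.comp_apply] at h1
        rw [map_add, h1]
        simp
  obtain ⟨w, hw⟩ := down (n + 2 - i.val) (by omega)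
  exact ⟨w, fun j hj => hw j (by have := Fin.val_ne_of_ne hj; omega)⟩

/-- The simplicial set underlying a simplicial abelian group. -/
abbrev underlyingSSet : SSet.{u} :=
  ((SimplicialObject.whiskering AddCommGrpCat.{u} (Type u)).obj (forget AddCommGrpCat)).obj A

/-- Simplicial abelian groups are Kan complexes. -/
instance : SSet.KanComplex (underlyingSSet A) := by
  rw [SSet.KanComplex.iff]
  intro n i f hf
  have key : ∃ w : A _⦋n + 1⦌, ∀ j (hj : j ≠ i), A.δ j w = SSet.yonedaEquiv (f j hj) := by
    obtain _ | n := n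
    -- In a horn of dimension one there is a single face, and no compatibility condition.
    · fin_cases i
      · refine ⟨A.σ 0 (SSet.yonedaEquiv (f 1 (by simp))), fun j hj => ?_⟩
        obtain rfl : j = 1 := by fin_cases j <;> simp_all
        exact ConcreteCategory.congr_hom (A.δ_comp_σ_succ (i := (0 : Fin 1))) _
      · refine ⟨A.σ 0 (SSet.yonedaEquiv (f 0 (by simp))), fun j hj => ?_⟩
        obtain rfl : j = 0 := by fin_cases j <;> simp_all
        exact ConcreteCategory.congr_hom (A.δ_comp_σ_self (i := (0 : Fin 1))) _
    · obtain ⟨x, hx⟩ : ∃ x : Fin (n + 3) → A _⦋n + 1⦌,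
          ∀ j (hj : j ≠ i), x j = SSet.yonedaEquiv (f j hj) :=
        ⟨fun j => if hj : j ≠ i then SSet.yonedaEquiv (f j hj) else (0 : A _⦋n + 1⦌),
          fun j hj => dif_pos hj⟩
      obtain ⟨w, hw⟩ := exists_horn_filler A i x (fun j k hjk hj hk => by
        have h := congrArg SSet.yonedaEquiv
          (hf j.castSucc k.succ hj hk (by simpa [Fin.lt_def, Nat.lt_succ_iff] using! hjk))
        rw [SSet.stdSimplex.yonedaEquiv_δ_comp, SSet.stdSimplex.yonedaEquiv_δ_comp] at h
        rw [hx _ hj, hx _ hk]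
        exact h)
      exact ⟨w, fun j hj => (hw j hj).trans (hx j hj)⟩
  obtain ⟨w, hw⟩ := key
  refine ⟨SSet.yonedaEquiv.symm w, fun j hj => ?_⟩
  apply SSet.yonedaEquiv.injective
  refine (SSet.stdSimplex.yonedaEquiv_δ_comp _ _).trans (Eq.trans ?_ (hw j hj))
  exact congrArg ((underlyingSSet A).δ j) (SSet.yonedaEquiv.apply_symm_apply _)

end Kan

/-! ### Weak equivalences are homology isomorphisms -/

section WeakEquivalence

open AlgebraicTopology

/-- The free simplicial abelian group on a simplicial set. -/
noncomputable abbrev freeSimplicial : SSet.{u} ⥤ SimplicialObject AddCommGrpCat.{u} :=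
  (SimplicialObject.whiskering (Type u) AddCommGrpCat.{u}).obj AddCommGrpCat.free

/-- The map of simplicial abelian groups adjoint to a map of simplicial sets into the underlying
simplicial set of a simplicial abelian group. -/
noncomputable def freeLift {X : SSet.{u}} {A : SimplicialObject AddCommGrpCat.{u}}
    (g : X ⟶ underlyingSSet A) : freeSimplicial.obj X ⟶ A :=
  freeSimplicial.map g ≫ Functor.whiskerLeft A AddCommGrpCat.adj.counit

/-- The inclusion of the generators. -/
noncomputable def freeUnit (X : SSet.{u}) : X ⟶ underlyingSSet (freeSimplicial.obj X) :=
  Functor.whiskerLeft X AddCommGrpCat.adj.unit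

theorem freeLift_freeUnit (X : SSet.{u}) : freeLift (freeUnit X) = 𝟙 _ := by
  exact NatTrans.ext (funext fun n => AddCommGrpCat.adj.left_triangle_components _)

theorem freeLift_comp {X Y : SSet.{u}} {A : SimplicialObject AddCommGrpCat.{u}} (f : X ⟶ Y)
    (g : Y ⟶ underlyingSSet A) : freeLift (f ≫ g) = freeSimplicial.map f ≫ freeLift g :=
  (congrArg (· ≫ _) (freeSimplicial.map_comp f g)).trans (Category.assoc _ _ _)

theorem freeLift_comp_map {X : SSet.{u}} {A B : SimplicialObject AddCommGrpCat.{u}}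
    (g : X ⟶ underlyingSSet A) (φ : A ⟶ B) :
    freeLift (g ≫ ((SimplicialObject.whiskering _ _).obj (forget AddCommGrpCat)).map φ) =
      freeLift g ≫ φ := by
  refine (freeLift_comp _ _).trans (Eq.trans ?_ (Category.assoc _ _ _).symm)
  exact congrArg (_ ≫ ·)
    (NatTrans.ext (funext fun n => AddCommGrpCat.adj.counit.naturality (φ.app n)))

theorem freeUnit_naturality {X Y : SSet.{u}} (f : X ⟶ Y) :
    f ≫ freeUnit Y = freeUnit X ≫ ((SimplicialObject.whiskering _ _).obj
      (forget AddCommGrpCat)).map (freeSimplicial.map f) :=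
  NatTrans.ext (funext fun n => AddCommGrpCat.adj.unit.naturality (f.app n))

/-- The map `[X, Z] → [X, Z']` given by composition with `φ : Z ⟶ Z'`. -/
def postcompHomotopyClasses (X : SSet.{u}) {Z Z' : SSet.{u}} (φ : Z ⟶ Z') :
    HomotopyClasses X Z → HomotopyClasses X Z' :=
  Quot.map (fun g => g ≫ φ) (by
    rintro g g' ⟨h⟩
    have h' : SSet.Homotopy (g ≫ φ) (g' ≫ φ) :=
      h.postcomp (SSet.RelativeMorphism.botEquiv.symm φ) (SSet.Subcomplex.isInitialBot.hom_ext _ _)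
    exact ⟨h'⟩)

/-- Homotopic maps into the underlying simplicial set of `A` have adjoints which agree in
homology. -/
theorem homologyMap_freeLift_eq {X : SSet.{u}} {A : SimplicialObject AddCommGrpCat.{u}}
    {g h : X ⟶ underlyingSSet A}
    (H : (Quot.mk _ g : HomotopyClasses X (underlyingSSet A)) = Quot.mk _ h) (n : ℕ) :
    HomologicalComplex.homologyMap ((alternatingFaceMapComplex _).map (freeLift g)) n =
      HomologicalComplex.homologyMap ((alternatingFaceMapComplex _).map (freeLift h)) n := by
  have key := Quot.eqvGen_exact H
  induction key with
  | rel g h r =>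
    obtain ⟨r⟩ := r
    exact ((r.toSimplicialObjectHomotopy.whiskerRight AddCommGrpCat.free).postcomp
      (Functor.whiskerLeft A AddCommGrpCat.adj.counit)).map_homology_eq n
  | refl => rfl
  | symm _ _ _ ih => exact (ih (Quot.eqvGen_sound ‹_›)).symm
  | trans _ _ _ _ _ ih1 ih2 =>
    exact (ih1 (Quot.eqvGen_sound ‹_›)).trans (ih2 (Quot.eqvGen_sound ‹_›))

/-- Weak equivalences are homology isomorphisms. As `ℤ[X]` is a Kan complex, the unit `X ⟶ ℤ[X]`
factors up to homotopy through `f`, by some `g : Y ⟶ ℤ[X]`; the adjoint of `g` is inverse to `f`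
in homology. -/
theorem quasiIso_of_isWeakEquivalence {X Y : SSet.{u}} {f : X ⟶ Y} (hf : IsWeakEquivalence f) :
    QuasiIso ((alternatingFaceMapComplex _).map (freeSimplicial.map f)) := by
  rw [quasiIso_iff]
  intro n
  rw [quasiIsoAt_iff_isIso_homologyMap]
  obtain ⟨⟨g⟩, hg⟩ := (hf (underlyingSSet (freeSimplicial.obj X))).2 (Quot.mk _ (freeUnit X))
  have hg' : (Quot.mk _ (f ≫ g) : HomotopyClasses X _) = Quot.mk _ (freeUnit X) := hg
  have h1 := homologyMap_freeLift_eq hg' n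
  have h2 : (Quot.mk _ (g ≫ ((SimplicialObject.whiskering _ _).obj
      (forget AddCommGrpCat)).map (freeSimplicial.map f)) : HomotopyClasses Y _) =
      Quot.mk _ (freeUnit Y) := by
    apply (hf (underlyingSSet (freeSimplicial.obj Y))).1
    change Quot.mk _ (f ≫ g ≫ _) = Quot.mk _ (f ≫ freeUnit Y)
    rw [freeUnit_naturality, ← Category.assoc]
    exact congrArg (postcompHomotopyClasses X _) hg'
  have h3 := homologyMap_freeLift_eq h2 n
  rw [freeLift_comp, freeLift_freeUnit, Functor.map_comp, HomologicalComplex.homologyMap_comp,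
    CategoryTheory.Functor.map_id, HomologicalComplex.homologyMap_id] at h1
  rw [freeLift_comp_map, freeLift_freeUnit, Functor.map_comp, HomologicalComplex.homologyMap_comp,
    CategoryTheory.Functor.map_id, HomologicalComplex.homologyMap_id] at h3
  exact ⟨_, h1, h3⟩

end WeakEquivalence

/-! ### Orbits of products with a finite `G`-set -/

section Orbits

variable {G : Type u} [Group G]

theorem types_hom_ext {X Y : Type u} {f g : X ⟶ Y} (h : ∀ x, f x = g x) : f = g := by
  ext x
  exact h x

theorem GSet.rho_one (S : GSet G) (x : S.V) : S.ρ 1 x = x := by simp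

theorem GSet.rho_mul (S : GSet G) (g h : G) (x : S.V) : S.ρ (g * h) x = S.ρ g (S.ρ h x) := by
  simp [End.mul_def]

theorem GSet.rho_inv_rho (S : GSet G) (g : G) (x : S.V) : S.ρ g⁻¹ (S.ρ g x) = x := by simp

theorem GSet.hom_rho {S T : GSet G} (f : S ⟶ T) (g : G) (x : S.V) :
    f.hom (S.ρ g x) = T.ρ g (f.hom x) :=
  ConcreteCategory.congr_hom (f.comm g) x

/-- The action of a group element on a finite `G`-set. -/
def FinGSet.act (S : FinGSet G) (g : G) (x : S.V) : S.V :=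
  ConcreteCategory.hom (C := FintypeCat) (X := S.V) (Y := S.V) (S.ρ g) x

theorem FinGSet.act_one (S : FinGSet G) (x : S.V) : S.act 1 x = x := by
  simp [FinGSet.act]

theorem FinGSet.act_mul (S : FinGSet G) (g h : G) (x : S.V) :
    S.act (g * h) x = S.act g (S.act h x) := by
  simp [FinGSet.act, End.mul_def]

theorem FinGSet.hom_act {S T : FinGSet G} (f : S ⟶ T) (g : G) (x : S.V) :
    f.hom (S.act g x) = T.act g (f.hom x) :=
  ConcreteCategory.congr_hom (f.comm g) x

theorem FinGSet.hom_ext {S T : FinGSet G} {f g : S ⟶ T} (h : ∀ x : S.V, f.hom x = g.hom x) :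
    f = g :=
  Action.Hom.ext (FintypeCat.hom_ext _ _ h)

theorem GSet.hom_ext {S T : GSet G} {f g : S ⟶ T} (h : ∀ x : S.V, f.hom x = g.hom x) :
    f = g :=
  Action.Hom.ext (by ext x; exact h x)

/-- The map of finite `G`-sets given by an equivariant function. -/
def FinGSet.homMk {S T : FinGSet G} (f : S.V → T.V) (hf : ∀ g x, f (S.act g x) = T.act g (f x)) :
    S ⟶ T where
  hom := FintypeCat.homMk f
  comm g := FintypeCat.hom_ext _ _ fun x => hf g x

/-- The map of `G`-sets given by an equivariant function. -/
def GSet.homMk {S T : GSet G} (f : S.V → T.V) (hf : ∀ g x, f (S.ρ g x) = T.ρ g (f x)) :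
    S ⟶ T where
  hom := ↾f
  comm g := by ext x; exact hf g x

/-- A finite `G`-set, regarded as a `G`-set. -/
def toGSet : FinGSet G ⥤ GSet G := FintypeCat.incl.mapAction G

variable (U : FinGSet G)

/-- The product of a `G`-set with a finite `G`-set. -/
def prodGSet : GSet G ⥤ GSet G where
  obj S :=
    { V := S.V × U.V
      ρ :=
        { toFun g := ↾fun x => (S.ρ g x.1, U.act g x.2)
          map_one' := types_hom_ext fun x =>
            Prod.ext (S.rho_one x.1) (U.act_one x.2)
          map_mul' g h := types_hom_ext fun x =>
            Prod.ext (S.rho_mul g h x.1) (U.act_mul g h x.2) } }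
  map f := GSet.homMk (fun x => (f.hom x.1, x.2)) fun g x => Prod.ext (GSet.hom_rho f g x.1) rfl

/-- The map into a product of a `G`-set with a finite `G`-set. -/
def pairMap {T : FinGSet G} {S : GSet G} (s : toGSet.obj T ⟶ S) (a : T ⟶ U) :
    toGSet.obj T ⟶ (prodGSet U).obj S :=
  GSet.homMk (fun t => (s.hom t, a.hom t)) fun g t =>
    Prod.ext (GSet.hom_rho s g t) (FinGSet.hom_act a g t)

/-- The transitive finite `G`-sets over a finite `G`-set `U`. If the isotropy groups of `U` are
`p`-groups, then so are those of its members. Morphisms are the maps over `U`. -/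
structure OrbitOver where
  /-- The underlying finite `G`-set. -/
  set : FinGSet G
  transitive : ∃ t₀ : set.V, ∀ t : set.V, ∃ g : G, set.act g t₀ = t
  /-- The structure map. -/
  toBase : set ⟶ U

namespace OrbitOver

instance : Category (OrbitOver U) where
  Hom A B := {φ : A.set ⟶ B.set // φ ≫ B.toBase = A.toBase}
  id A := ⟨𝟙 _, Category.id_comp _⟩
  comp φ ψ := ⟨φ.1 ≫ ψ.1, by rw [Category.assoc, ψ.2, φ.2]⟩

/-- The underlying finite `G`-set of a transitive finite `G`-set over `U`. -/
def forget : OrbitOver U ⥤ FinGSet G where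
  obj A := A.set
  map φ := φ.1

/-- The underlying `G`-set of a transitive finite `G`-set over `U`. -/
abbrev underlying : OrbitOver U ⥤ GSet G := forget U ⋙ toGSet

variable {U}

/-- Maps out of a transitive `G`-set agree if they do so at one point. -/
theorem underlying_hom_ext (A : OrbitOver U) {S : GSet G} {s s' : (underlying U).obj A ⟶ S}
    (t : A.set.V) (h : s.hom t = s'.hom t) : s = s' := by
  obtain ⟨t₀, ht₀⟩ := A.transitive
  obtain ⟨g, rfl⟩ := ht₀ t
  have h0 : s.hom t₀ = s'.hom t₀ := by
    have h1 := (GSet.hom_rho s g t₀).symm.trans (h.trans (GSet.hom_rho s' g t₀))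
    have h2 := congrArg (S.ρ g⁻¹) h1
    simpa using h2
  refine GSet.hom_ext fun x => ?_
  obtain ⟨k, rfl⟩ := ht₀ x
  exact (GSet.hom_rho s k t₀).trans ((congrArg (S.ρ k) h0).trans (GSet.hom_rho s' k t₀).symm)

end OrbitOver

variable [Finite G] {U} {S : GSet G}

/-- An orbit of `S × U`, as a transitive finite `G`-set over `U`. -/
def orbitOver (q : Orbits ((prodGSet U).obj S)) : OrbitOver U where
  set := orbit q
  transitive := by
    obtain ⟨x, rfl⟩ := Quotient.exists_rep q
    refine ⟨(⟨x, rfl⟩ : OrbitElts _), fun (y : OrbitElts _) => ?_⟩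
    obtain ⟨g, hg⟩ := Quotient.exact y.2.symm
    exact ⟨g, Subtype.ext hg⟩
  toBase := FinGSet.homMk (fun x : OrbitElts q => x.1.2) fun _ _ => rfl

/-- The projection of an orbit of `S × U` to `S`. -/
def orbitFst (q : Orbits ((prodGSet U).obj S)) :
    (OrbitOver.underlying U).obj (orbitOver q) ⟶ S :=
  GSet.homMk (fun x : OrbitElts q => x.1.1) fun _ _ => rfl

/-- A map from a transitive `G`-set `A` over `U` to `S` factors through an orbit of `S × U`. -/
theorem exists_classifying (A : OrbitOver U) (s : (OrbitOver.underlying U).obj A ⟶ S) :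
    ∃ (q : Orbits ((prodGSet U).obj S)) (φ : A ⟶ orbitOver q),
      s = (OrbitOver.underlying U).map φ ≫ orbitFst q := by
  obtain ⟨t₀, ht₀⟩ := A.transitive
  let P := pairMap U s A.toBase
  have hP (t : A.set.V) : Quotient.mk (orbitSetoid _) (P.hom t) =
      Quotient.mk (orbitSetoid _) (P.hom t₀) := by
    obtain ⟨g, rfl⟩ := ht₀ t
    refine (congrArg _ (GSet.hom_rho P g t₀)).trans (mk_rho _ g _)
  refine ⟨Quotient.mk _ (P.hom t₀), ⟨FinGSet.homMk (fun t => (⟨P.hom t, hP t⟩ : OrbitElts _))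
    fun g t => Subtype.ext (GSet.hom_rho P g t), ?_⟩, ?_⟩
  · exact FinGSet.hom_ext fun _ => rfl
  · exact GSet.hom_ext fun _ => rfl

/-- The factorization through an orbit of `S × U` is unique. -/
theorem classifying_unique (A : OrbitOver U) {q q' : Orbits ((prodGSet U).obj S)}
    (φ : A ⟶ orbitOver q) (φ' : A ⟶ orbitOver q')
    (h : (OrbitOver.underlying U).map φ ≫ orbitFst q =
      (OrbitOver.underlying U).map φ' ≫ orbitFst q') :
    ∃ e : q = q', φ ≫ eqToHom (congrArg orbitOver e) = φ' := by
  let y (t : A.set.V) : OrbitElts q := φ.1.hom t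
  let y' (t : A.set.V) : OrbitElts q' := φ'.1.hom t
  have key (t : A.set.V) : (y t).1 = (y' t).1 := by
    have h1 : ((OrbitOver.underlying U).map φ ≫ orbitFst q).hom t =
        ((OrbitOver.underlying U).map φ' ≫ orbitFst q').hom t := by rw [h]
    refine Prod.ext h1 ?_
    have h2 : φ.1 ≫ (orbitOver q).toBase = φ'.1 ≫ (orbitOver q').toBase := φ.2.trans φ'.2.symm
    exact ConcreteCategory.congr_hom (congrArg Action.Hom.hom h2) t
  obtain ⟨t₀, -⟩ := A.transitive
  obtain rfl : q = q' := by
    rw [← (y t₀).2, ← (y' t₀).2, key]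
  refine ⟨rfl, ?_⟩
  rw [eqToHom_refl, Category.comp_id]
  exact Subtype.ext (FinGSet.hom_ext fun t => Subtype.ext (key t))

end Orbits

/-! ### The linearization of a `G`-set -/

section Presheaves

variable {G : Type u} [Group G] (U : FinGSet G)

/-- The presheaf `A ↦ ℤ[Hom_G(A, S)]` on the transitive finite `G`-sets over `U`. -/
noncomputable def linearization :
    GSet G ⥤ (OrbitOver U)ᵒᵖ ⥤ AddCommGrpCat.{u} :=
  yoneda ⋙ (Functor.whiskeringLeft _ _ _).obj (OrbitOver.underlying U).op ⋙
    (Functor.whiskeringRight _ _ _).obj AddCommGrpCat.free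

variable {U} {S : GSet G}

/-- The generator of `linearization` given by a map. -/
def generator {A : OrbitOver U} (s : (OrbitOver.underlying U).obj A ⟶ S) :
    ((linearization U).obj S).obj (op A) :=
  FreeAbelianGroup.of s

theorem map_generator {A B : OrbitOver U} (φ : A ⟶ B)
    (s : (OrbitOver.underlying U).obj B ⟶ S) :
    ((linearization U).obj S).map φ.op (generator s) =
      generator ((OrbitOver.underlying U).map φ ≫ s) :=
  FreeAbelianGroup.map_of_apply _

theorem linearization_map_generator {A : OrbitOver U} {T : GSet G} (f : S ⟶ T)
    (s : (OrbitOver.underlying U).obj A ⟶ S) :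
    ((linearization U).map f).app (op A) (generator s) = generator (s ≫ f) :=
  FreeAbelianGroup.map_of_apply _

theorem linearization_hom_ext {N : (OrbitOver U)ᵒᵖ ⥤ AddCommGrpCat.{u}}
    {β β' : (linearization U).obj S ⟶ N}
    (h : ∀ A (s : (OrbitOver.underlying U).obj A ⟶ S),
      β.app (op A) (generator s) = β'.app (op A) (generator s)) : β = β' := by
  ext ⟨A⟩ : 3
  exact FreeAbelianGroup.lift_ext _ _ (h A)

variable [Finite G]

/-- The values of a map out of `linearization` at the generators given by the orbits of `S × U`. -/
noncomputable def orbitValues (N : (OrbitOver U)ᵒᵖ ⥤ AddCommGrpCat.{u}) :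
    ((linearization U).obj S ⟶ N) →+
      (∀ q : Orbits ((prodGSet U).obj S), N.obj (op (orbitOver q))) where
  toFun β q := β.app (op (orbitOver q)) (generator (orbitFst q))
  map_zero' := rfl
  map_add' _ _ := rfl

theorem app_generator {N : (OrbitOver U)ᵒᵖ ⥤ AddCommGrpCat.{u}}
    (β : (linearization U).obj S ⟶ N) {A : OrbitOver U} {q : Orbits ((prodGSet U).obj S)}
    (φ : A ⟶ orbitOver q) :
    β.app (op A) (generator ((OrbitOver.underlying U).map φ ≫ orbitFst q)) =
      N.map φ.op (orbitValues N β q) := by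
  rw [← map_generator]
  exact ConcreteCategory.congr_hom (β.naturality φ.op) _

/-- The linearization of `S` is the direct sum, over the orbits `q` of `S × U`, of the free
presheaves represented by the `q`: a map from a transitive `G`-set `A` over `U` to `S` is the same
thing as a map from `A` to some orbit of `S × U` over `U`. -/
theorem orbitValues_bijective (N : (OrbitOver U)ᵒᵖ ⥤ AddCommGrpCat.{u}) :
    Function.Bijective (orbitValues (S := S) N) := by
  refine ⟨fun β β' h => linearization_hom_ext fun A s => ?_, fun n => ?_⟩
  · obtain ⟨q, φ, rfl⟩ := exists_classifying A s
    rw [app_generator, app_generator, h]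
  · choose q φ hφ using fun A => exists_classifying (U := U) (S := S) A
    have key {A : OrbitOver U} (s : (OrbitOver.underlying U).obj A ⟶ S)
        (q' : Orbits ((prodGSet U).obj S)) (φ' : A ⟶ orbitOver q')
        (h : s = (OrbitOver.underlying U).map φ' ≫ orbitFst q') :
        N.map (φ A s).op (n (q A s)) = N.map φ'.op (n q') := by
      obtain ⟨e, he⟩ := classifying_unique A (φ A s) φ' ((hφ A s).symm.trans h)
      generalize φ A s = ψ at he
      generalize q A s = q'' at e ψ he
      subst e
      rw [← he]
      simp
    let b (A : OrbitOver U) : ((linearization U).obj S).obj (op A) ⟶ N.obj (op A) :=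
      AddCommGrpCat.ofHom (FreeAbelianGroup.lift fun s => N.map (φ A s).op (n (q A s)))
    have hb (A : OrbitOver U) (s : (OrbitOver.underlying U).obj A ⟶ S) :
        b A (generator s) = N.map (φ A s).op (n (q A s)) :=
      FreeAbelianGroup.lift_apply_of _ _
    refine ⟨⟨fun A => b A.unop, fun A B ψ => ?_⟩, funext fun q' => ?_⟩
    · refine AddCommGrpCat.hom_ext (FreeAbelianGroup.lift_ext _ _ fun s => ?_)
      have h := key ((OrbitOver.underlying U).map ψ.unop ≫ s) (q A.unop s)
        (ψ.unop ≫ φ A.unop s) (by rw [Functor.map_comp, Category.assoc, ← hφ])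
      rw [op_comp, Functor.map_comp, ← hb] at h
      refine (congrArg (b B.unop) (map_generator ψ.unop s)).trans (h.trans ?_)
      exact congrArg (N.map ψ) (hb A.unop s).symm
    · refine (hb _ _).trans ((key (orbitFst q') q' (𝟙 _) (by simp)).trans ?_)
      simp

/-- As a direct sum of free presheaves on representables, the linearization is projective. -/
instance : Projective ((linearization U).obj S) where
  factors {E N} β e _ := by
    have he (A) : Function.Surjective (e.app A) :=
      (AddCommGrpCat.epi_iff_surjective _).mp inferInstance
    choose n hn using fun q => he _ (orbitValues _ β q)
    obtain ⟨γ, hγ⟩ := (orbitValues_bijective (S := S) E).2 n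
    refine ⟨γ, (orbitValues_bijective (S := S) N).1 (funext fun q => ?_)⟩
    rw [← hn, ← hγ]
    rfl

end Presheaves

/-! ### Chains of linearizations -/

section Pointwise

theorem quasiIso_of_evaluation {J : Type v} [Category.{w} J]
    {K L : ChainComplex (J ⥤ AddCommGrpCat.{u}) ℕ} (f : K ⟶ L)
    (h : ∀ j, QuasiIso ((((evaluation J AddCommGrpCat.{u}).obj j).mapHomologicalComplex _).map f)) :
    QuasiIso f := by
  rw [quasiIso_iff]
  intro n
  rw [quasiIsoAt_iff, ShortComplex.quasiIso_iff, NatTrans.isIso_iff_isIso_app]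
  intro j
  have hj := (quasiIso_iff _).mp (h j) n
  rw [quasiIsoAt_iff, ShortComplex.quasiIso_iff] at hj
  exact (NatIso.isIso_map_iff
    (ShortComplex.homologyFunctorIso ((evaluation J AddCommGrpCat.{u}).obj j))
    ((HomologicalComplex.shortComplexFunctor _ _ n).map f)).mp hj

end Pointwise

section PresheafChains

open AlgebraicTopology

variable {G : Type u} [Group G] {U : FinGSet G}

/-- Evaluation at a point of a transitive `G`-set `A` identifies the maps `A ⟶ S` with the fixed
points of the isotropy subgroup. -/
def evalPoint (A : OrbitOver U) (t : A.set.V) :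
    coyoneda.obj (op ((OrbitOver.underlying U).obj A)) ⟶
      fixedPointsFunctor (isotropy ((OrbitOver.underlying U).obj A) t) where
  app _ := ↾fun s => ⟨s.hom t, fun g hg =>
    (GSet.hom_rho s g t).symm.trans (congrArg s.hom hg)⟩
  naturality _ _ _ := rfl

/-- A transitive `G`-set with isotropy group `K` at a point represents the functor of `K`-fixed
points. -/
instance (A : OrbitOver U) (t : A.set.V) : IsIso (evalPoint A t) := by
  rw [NatTrans.isIso_iff_isIso_app]
  intro S
  rw [isIso_iff_bijective]
  refine ⟨fun s s' h => A.underlying_hom_ext t (congrArg Subtype.val h), fun ⟨x, hx⟩ => ?_⟩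
  let T := (OrbitOver.underlying U).obj A
  have htrans : ∀ y : T.V, ∃ g : G, T.ρ g t = y := by
    obtain ⟨t₀, ht₀⟩ := A.transitive
    intro y
    obtain ⟨g, rfl⟩ := ht₀ y
    obtain ⟨h, rfl⟩ := ht₀ t
    exact ⟨g * h⁻¹, (T.rho_mul _ _ _).trans (congrArg (T.ρ g) (T.rho_inv_rho h t₀))⟩
  choose γ hγ using htrans
  have key (g h : G) (e : T.ρ g t = T.ρ h t) : S.ρ g x = S.ρ h x := by
    have h1 : S.ρ (h⁻¹ * g) x = x :=
      hx _ ((T.rho_mul _ _ _).trans ((congrArg (T.ρ h⁻¹) e).trans (T.rho_inv_rho h t)))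
    have h2 := S.rho_mul h (h⁻¹ * g) x
    rwa [mul_inv_cancel_left, h1] at h2
  refine ⟨GSet.homMk (fun y => S.ρ (γ y) x) fun g y => ?_, Subtype.ext ?_⟩
  · refine (key (γ (T.ρ g y)) (g * γ y) ?_).trans (S.rho_mul _ _ _)
    exact (hγ _).trans ((congrArg (T.ρ g) (hγ y)).symm.trans (T.rho_mul g (γ y) t).symm)
  · exact (key (γ t) 1 ((hγ t).trans (T.rho_one t).symm)).trans (S.rho_one x)

theorem isPGroup_isotropy {p : ℕ}
    (hU : ∀ u : U.V, IsPGroup p (isotropy (toGSet.obj U) u)) (A : OrbitOver U) (t : A.set.V) :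
    IsPGroup p (isotropy ((OrbitOver.underlying U).obj A) t) :=
  (hU (A.toBase.hom t)).to_le fun g hg =>
    (FinGSet.hom_act A.toBase g t).symm.trans (congrArg A.toBase.hom hg)

/-- The chain complex of presheaves `A ↦ ℤ[Hom_G(A, X_•)]` attached to a `G`-space `X`. -/
noncomputable abbrev presheafChains (U : FinGSet G) :
    GSpace G ⥤ ChainComplex ((OrbitOver U)ᵒᵖ ⥤ AddCommGrpCat.{u}) ℕ :=
  (SimplicialObject.whiskering _ _).obj (linearization U) ⋙ alternatingFaceMapComplex _

/-- At a transitive `G`-set with isotropy group `K`, the complex `presheafChains` of `X` is the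
complex of chains on `X^K`. -/
theorem quasiIso_presheafChains {p : ℕ}
    (hU : ∀ u : U.V, IsPGroup p (isotropy (toGSet.obj U) u)) {Y X : GSpace G} (f : Y ⟶ X)
    (hf : ∀ K : Subgroup G, IsPGroup p K → IsWeakEquivalence ((fixedPoints K).map f)) :
    QuasiIso ((presheafChains U).map f) := by
  refine quasiIso_of_evaluation _ fun ⟨A⟩ => ?_
  obtain ⟨t, -⟩ := A.transitive
  have h1 := quasiIso_of_isWeakEquivalence (hf _ (isPGroup_isotropy hU A t))
  let E := (evaluation (OrbitOver U)ᵒᵖ AddCommGrpCat.{u}).obj (op A)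
  let i1 := (SimplicialObject.whiskering (GSet G) (Type u)).mapIso (asIso (evalPoint A t))
  let i2 : fixedPoints _ ⋙ freeSimplicial ⋙ alternatingFaceMapComplex _ ≅
      (SimplicialObject.whiskering _ _).obj (linearization U) ⋙
        (SimplicialObject.whiskering _ _).obj E ⋙ alternatingFaceMapComplex _ :=
    Functor.isoWhiskerRight i1.symm (freeSimplicial ⋙ alternatingFaceMapComplex _)
  let i3 := i2 ≪≫ Functor.isoWhiskerLeft ((SimplicialObject.whiskering _ _).obj (linearization U))
    (eqToIso (map_alternatingFaceMapComplex E)).symm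
  exact quasiIso_of_arrow_mk_iso _ _
    (Arrow.isoMk (i3.app Y) (i3.app X) (i3.hom.naturality f).symm) (hφ := h1)

/-- A quasi-isomorphism between nonnegative complexes of projectives is a homotopy equivalence. -/
theorem homotopyEquivalences_presheafChains [Finite G] {p : ℕ}
    (hU : ∀ u : U.V, IsPGroup p (isotropy (toGSet.obj U) u)) {Y X : GSpace G} (f : Y ⟶ X)
    (hf : ∀ K : Subgroup G, IsPGroup p K → IsWeakEquivalence ((fixedPoints K).map f)) :
    HomologicalComplex.homotopyEquivalences _ _ ((presheafChains U).map f) := by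
  have (Z : GSpace G) (n : ℕ) : Projective (((presheafChains U).obj Z).X n) :=
    inferInstanceAs (Projective ((linearization U).obj (Z.obj _)))
  rw [← ChainComplex.quasiIso_iff_of_projective]
  exact quasiIso_presheafChains hU f hf

end PresheafChains

/-! ### Transport of homotopy equivalences -/

section HomotopyEquivalences

variable {ι : Type*} {V : Type*} [Category V] [Preadditive V] {W : Type*} [Category W]
  [Preadditive W] {c : ComplexShape ι}

theorem homotopyEquivalences_map_iff (F : V ⥤ W) [F.Additive] [F.Full] [F.Faithful]
    {K L : HomologicalComplex V c} (f : K ⟶ L) :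
    HomologicalComplex.homotopyEquivalences W c ((F.mapHomologicalComplex c).map f) ↔
      HomologicalComplex.homotopyEquivalences V c f := by
  rw [← HomologicalComplex.isIso_quotient_map_iff_homotopyEquivalences,
    ← HomologicalComplex.isIso_quotient_map_iff_homotopyEquivalences]
  exact isIso_iff_of_reflects_iso ((HomotopyCategory.quotient V c).map f) (F.mapHomotopyCategory c)

theorem homotopyEquivalences_map (F : V ⥤ W) [F.Additive]
    {K L : HomologicalComplex V c} {f : K ⟶ L}
    (hf : HomologicalComplex.homotopyEquivalences V c f) :
    HomologicalComplex.homotopyEquivalences W c ((F.mapHomologicalComplex c).map f) := by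
  obtain ⟨e, rfl⟩ := hf
  exact ⟨F.mapHomotopyEquiv e, rfl⟩

end HomotopyEquivalences

/-! ### The additive extension as a coproduct -/

section Extension

variable {G : Type u} [Group G] [Finite G]
variable {C : Type v} [Category.{w} C] [HasCoproducts.{u} C] (F : FinGSet G ⥤ C)

/-- The inclusion of the summand of `additiveExtension` given by an orbit. -/
noncomputable def extensionι {S : GSet G} (o : Orbits S) :
    F.obj (orbit o) ⟶ (additiveExtension F).obj S :=
  Sigma.ι (fun q : Orbits S => F.obj (orbit q)) o

variable {F}

theorem extension_hom_ext {S : GSet G} {c : C} {α β : (additiveExtension F).obj S ⟶ c}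
    (h : ∀ o, extensionι F o ≫ α = extensionι F o ≫ β) : α = β :=
  Sigma.hom_ext _ _ h

/-- The map out of `additiveExtension` with given restrictions to the summands. -/
noncomputable def extensionDesc {S : GSet G} {c : C} (n : ∀ o : Orbits S, F.obj (orbit o) ⟶ c) :
    (additiveExtension F).obj S ⟶ c :=
  Sigma.desc n

theorem extensionι_desc {S : GSet G} {c : C} (n : ∀ o : Orbits S, F.obj (orbit o) ⟶ c)
    (o : Orbits S) : extensionι F o ≫ extensionDesc n = n o :=
  Sigma.ι_desc _ _

theorem extensionι_map {S T : GSet G} (f : S ⟶ T) (o : Orbits S) (o' : Orbits T)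
    (h : mapOrbits f o = o') :
    extensionι F o ≫ (additiveExtension F).map f = F.map (orbitMap f o o' h) ≫ extensionι F o' :=
  (Sigma.ι_desc _ _).trans (map_orbitMap_comp_ι F f o o' h)

end Extension

/-! ### Chains on products with a finite `G`-set -/

section Realization

open AlgebraicTopology

variable {G : Type u} [Group G] [Finite G] (U : FinGSet G)
variable {C : Type v} [Category.{u} C] [Preadditive C] [HasCoproducts.{u} C] (F : FinGSet G ⥤ C)

/-- The presheaf `A ↦ Hom(F(A), c)` on the transitive finite `G`-sets over `U`. -/
noncomputable def coefficientPresheaf : C ⥤ (OrbitOver U)ᵒᵖ ⥤ AddCommGrpCat.{u} :=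
  preadditiveYoneda ⋙ (Functor.whiskeringLeft _ _ _).obj (OrbitOver.forget U ⋙ F).op

/-- The extension of `F` to all `G`-sets, evaluated on products with `U`. -/
noncomputable abbrev prodExtension : GSet G ⥤ C := prodGSet U ⋙ additiveExtension F

variable {U F}

/-- Maps out of the coproduct of the `F(q)`, where `q` runs over the orbits of `S × U`, agree with
maps out of the linearization of `S`. -/
noncomputable def realizationEquiv (S : GSet G) (c : C) :
    ((prodExtension U F).obj S ⟶ c) ≃
      ((linearization U).obj S ⟶ (coefficientPresheaf U F).obj c) :=
  Equiv.trans
    { toFun := fun α q => extensionι F q ≫ α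
      invFun := extensionDesc
      left_inv := fun _ => extension_hom_ext fun q => extensionι_desc _ q
      right_inv := fun n => funext fun q => extensionι_desc n q }
    (Equiv.ofBijective _ (orbitValues_bijective (S := S) ((coefficientPresheaf U F).obj c))).symm

theorem orbitValues_realizationEquiv {S : GSet G} {c : C} (α : (prodExtension U F).obj S ⟶ c)
    (q : Orbits ((prodGSet U).obj S)) :
    orbitValues _ (realizationEquiv S c α) q = extensionι F q ≫ α :=
  congrFun ((Equiv.ofBijective _ (orbitValues_bijective (S := S)
    ((coefficientPresheaf U F).obj c))).apply_symm_apply _) q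

theorem realizationEquiv_eq {S : GSet G} {c : C} {α : (prodExtension U F).obj S ⟶ c}
    {β : (linearization U).obj S ⟶ (coefficientPresheaf U F).obj c}
    (h : ∀ q, orbitValues _ β q = extensionι F q ≫ α) :
    realizationEquiv S c α = β :=
  (orbitValues_bijective _).1 (funext fun q => (orbitValues_realizationEquiv α q).trans (h q).symm)

theorem realizationEquiv_add {S : GSet G} {c : C} (α α' : (prodExtension U F).obj S ⟶ c) :
    realizationEquiv S c (α + α') = realizationEquiv S c α + realizationEquiv S c α' :=
  realizationEquiv_eq fun q => by
    rw [map_add, Pi.add_apply, orbitValues_realizationEquiv, orbitValues_realizationEquiv]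
    exact (Preadditive.comp_add _ _ _ _ _ _).symm

theorem realizationEquiv_comp {S : GSet G} {c c' : C} (α : (prodExtension U F).obj S ⟶ c)
    (h : c ⟶ c') :
    realizationEquiv S c' (α ≫ h) =
      realizationEquiv S c α ≫ (coefficientPresheaf U F).map h :=
  realizationEquiv_eq fun q =>
    (congrArg (· ≫ h) (orbitValues_realizationEquiv α q)).trans (Category.assoc _ _ _)

theorem realizationEquiv_map_comp {S T : GSet G} (f : S ⟶ T) {c : C}
    (α : (prodExtension U F).obj T ⟶ c) :
    realizationEquiv S c ((prodExtension U F).map f ≫ α) =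
      (linearization U).map f ≫ realizationEquiv T c α :=
  realizationEquiv_eq fun q => by
    let f' := (prodGSet U).map f
    let ψ : orbitOver q ⟶ orbitOver (mapOrbits f' q) :=
      ⟨orbitMap f' q _ rfl, FinGSet.hom_ext fun _ => rfl⟩
    have h1 : orbitFst q ≫ f = (OrbitOver.underlying U).map ψ ≫ orbitFst (mapOrbits f' q) :=
      GSet.hom_ext fun _ => rfl
    refine (congrArg ((realizationEquiv T c α).app (op (orbitOver q)))
      ((linearization_map_generator f (orbitFst q)).trans (congrArg generator h1))).trans ?_
    refine (app_generator _ ψ).trans ?_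
    rw [orbitValues_realizationEquiv]
    refine (Category.assoc _ _ _).symm.trans (Eq.trans ?_ (Category.assoc _ _ _))
    exact congrArg (· ≫ α) (extensionι_map f' q _ rfl).symm

variable (U) in
/-- The category of `G`-sets, with the maps of their linearizations as morphisms. It is a full
subcategory of the category of presheaves, whence a preadditive category. -/
abbrev LinearGSet : Type (u + 1) :=
  InducedCategory ((OrbitOver U)ᵒᵖ ⥤ AddCommGrpCat.{u}) (linearization U).obj

variable (U) in
/-- The functor from `G`-sets to linearized `G`-sets. -/
noncomputable def toLinearGSet : GSet G ⥤ LinearGSet U where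
  obj S := S
  map f := ⟨(linearization U).map f⟩
  map_id S := InducedCategory.hom_ext ((linearization U).map_id S)
  map_comp f g := InducedCategory.hom_ext ((linearization U).map_comp f g)

variable (F) in
/-- The map induced by a map of linearizations, by the Yoneda lemma and `realizationEquiv`. -/
noncomputable def realizationMap {S T : GSet G}
    (φ : (linearization U).obj S ⟶ (linearization U).obj T) :
    (prodExtension U F).obj S ⟶ (prodExtension U F).obj T :=
  (realizationEquiv S _).symm (φ ≫ realizationEquiv T _ (𝟙 _))

theorem realizationEquiv_realizationMap_comp {S T : GSet G}
    (φ : (linearization U).obj S ⟶ (linearization U).obj T) {c : C}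
    (α : (prodExtension U F).obj T ⟶ c) :
    realizationEquiv S c (realizationMap F φ ≫ α) = φ ≫ realizationEquiv T c α := by
  rw [realizationEquiv_comp, realizationMap, Equiv.apply_symm_apply, Category.assoc,
    ← realizationEquiv_comp, Category.id_comp]

theorem realizationMap_eq {S T : GSet G}
    {φ : (linearization U).obj S ⟶ (linearization U).obj T}
    {α : (prodExtension U F).obj S ⟶ (prodExtension U F).obj T}
    (h : realizationEquiv S _ α = φ ≫ realizationEquiv T _ (𝟙 _)) : realizationMap F φ = α := by
  rw [realizationMap, ← h, Equiv.symm_apply_apply]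

variable (U F) in
/-- The functor on linearized `G`-sets which extends `prodExtension`. -/
noncomputable def realization : LinearGSet U ⥤ C where
  obj S := (prodExtension U F).obj S
  map φ := realizationMap F φ.hom
  map_id S := realizationMap_eq (Category.id_comp _).symm
  map_comp φ ψ := realizationMap_eq (by
    rw [realizationEquiv_realizationMap_comp, ← Category.comp_id (realizationMap F ψ.hom),
      realizationEquiv_realizationMap_comp]
    exact (Category.assoc _ _ _).symm)

instance : (realization U F).Additive where
  map_add {S T φ ψ} := realizationMap_eq (by
    refine (realizationEquiv_add (realizationMap F φ.hom) (realizationMap F ψ.hom)).trans ?_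
    rw [← Category.comp_id (realizationMap F φ.hom), ← Category.comp_id (realizationMap F ψ.hom),
      realizationEquiv_realizationMap_comp, realizationEquiv_realizationMap_comp]
    exact (Preadditive.add_comp _ _ _ _ _ _).symm)

/-- The realization functor extends `prodExtension`. -/
noncomputable def toLinearGSetCompRealization :
    toLinearGSet U ⋙ realization U F ≅ prodExtension U F :=
  NatIso.ofComponents (fun _ => Iso.refl _) fun {S T} f => by
    have h : realizationMap F ((linearization U).map f) = (prodExtension U F).map f :=
      realizationMap_eq (by rw [← realizationEquiv_map_comp, Category.comp_id])
    exact (Category.comp_id _).trans (h.trans (Category.id_comp _).symm)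

instance : (inducedFunctor (linearization U).obj).Additive where

/-- The functor `S ↦ F(S × U)` extends to an additive functor on linearizations, and as such it
preserves the homotopy equivalence `homotopyEquivalences_presheafChains`. -/
theorem homotopyEquivalences_prodExtension {p : ℕ}
    (hU : ∀ u : U.V, IsPGroup p (isotropy (toGSet.obj U) u)) {Y X : GSpace G} (f : Y ⟶ X)
    (hf : ∀ K : Subgroup G, IsPGroup p K → IsWeakEquivalence ((fixedPoints K).map f)) :
    HomologicalComplex.homotopyEquivalences C _ (((SimplicialObject.whiskering _ _).obj
      (prodExtension U F) ⋙ alternatingFaceMapComplex C).map f) := by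
  have h := homotopyEquivalences_presheafChains hU f hf
  let L := (SimplicialObject.whiskering _ _).obj (toLinearGSet U)
  let J := inducedFunctor (linearization U).obj
  let i1 : L ⋙ alternatingFaceMapComplex _ ⋙ J.mapHomologicalComplex _ ≅ presheafChains U :=
    Functor.isoWhiskerLeft L (eqToIso (map_alternatingFaceMapComplex J))
  have h2 : HomologicalComplex.homotopyEquivalences _ _
      ((J.mapHomologicalComplex _).map ((L ⋙ alternatingFaceMapComplex _).map f)) :=
    ((HomologicalComplex.homotopyEquivalences _ _).arrow_mk_iso_iff
      (Arrow.isoMk (i1.app Y) (i1.app X) (i1.hom.naturality f).symm)).mpr h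
  rw [homotopyEquivalences_map_iff] at h2
  have h3 := homotopyEquivalences_map (realization U F) h2
  let i2 : L ⋙ alternatingFaceMapComplex _ ⋙ (realization U F).mapHomologicalComplex _ ≅
      (SimplicialObject.whiskering _ _).obj (prodExtension U F) ⋙ alternatingFaceMapComplex C :=
    Functor.isoWhiskerLeft L (eqToIso (map_alternatingFaceMapComplex (realization U F))) ≪≫
      Functor.isoWhiskerRight ((SimplicialObject.whiskering _ _).mapIso
        toLinearGSetCompRealization) (alternatingFaceMapComplex C)
  exact ((HomologicalComplex.homotopyEquivalences _ _).arrow_mk_iso_iff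
      (Arrow.isoMk (i2.app Y) (i2.app X) (i2.hom.naturality f).symm)).mp h3

end Realization

/-! ### Extending transfers to all `G`-sets -/

section Transfer

variable {G : Type u} [Group G] [Finite G]

/-- The inclusion of an orbit of a `G`-set. -/
def orbitInclusion {S : GSet G} (o : Orbits S) : toGSet.obj (orbit o) ⟶ S :=
  GSet.homMk (fun x : OrbitElts o => x.1) fun _ _ => rfl

/-- The inclusion of an orbit of a finite `G`-set. -/
def finOrbitInclusion {T : FinGSet G} (o : Orbits (toGSet.obj T)) : orbit o ⟶ T :=
  FinGSet.homMk (fun x : OrbitElts o => x.1) fun _ _ => rfl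

variable {C : Type v} [Category.{u} C] [HasCoproducts.{u} C] (F : FinGSet G ⥤ C)

/-- The comparison of the additive extension of `F` with `F` on finite `G`-sets. It is invertible
if and only if `F` takes the decomposition of a finite `G`-set into orbits to a coproduct. -/
noncomputable def extensionComparison : toGSet ⋙ additiveExtension F ⟶ F where
  app T := extensionDesc fun o : Orbits (toGSet.obj T) => F.map (finOrbitInclusion o)
  naturality {T T'} f := extension_hom_ext fun o => by
    have h := extensionι_map (F := F) (toGSet.map f) o _ rfl
    refine (Category.assoc _ _ _).symm.trans ((congrArg (· ≫ _) h).trans ?_)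
    refine (Category.assoc _ _ _).trans ((congrArg (_ ≫ ·) (extensionι_desc _ _)).trans ?_)
    refine Eq.trans ?_ (Category.assoc _ _ _)
    refine Eq.trans ?_ (congrArg (· ≫ F.map f) (extensionι_desc _ _)).symm
    rw [← F.map_comp, ← F.map_comp]
    exact congrArg F.map (FinGSet.hom_ext fun _ => rfl)

variable {F}

theorem mapOrbits_orbitInclusion {S : GSet G} (o : Orbits S) (o' : Orbits (toGSet.obj (orbit o))) :
    mapOrbits (orbitInclusion o) o' = o := by
  obtain ⟨x, rfl⟩ := Quotient.exists_rep o'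
  exact (show OrbitElts o from x).2

theorem extensionComparison_orbit {S : GSet G} (o : Orbits S) :
    (extensionComparison F).app (orbit o) ≫ extensionι F o =
      (additiveExtension F).map (orbitInclusion o) :=
  extension_hom_ext fun o' => by
    refine Eq.trans ?_ (extensionι_map _ o' o (mapOrbits_orbitInclusion o o')).symm
    refine (Category.assoc _ _ _).symm.trans (congrArg (· ≫ _) ((extensionι_desc _ _).trans ?_))
    exact congrArg F.map (FinGSet.hom_ext fun _ => rfl)

variable (U : FinGSet G)

/-- The product with a finite `G`-set, on finite `G`-sets. -/
def prodFinGSet : FinGSet G ⥤ FinGSet G where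
  obj T :=
    { V := ⟨T.V × U.V, inferInstanceAs (Finite (T.V × U.V))⟩
      ρ :=
        { toFun g := FintypeCat.homMk fun x : T.V × U.V => (T.act g x.1, U.act g x.2)
          map_one' := FintypeCat.hom_ext _ _ fun x : T.V × U.V =>
            Prod.ext (T.act_one x.1) (U.act_one x.2)
          map_mul' g h := FintypeCat.hom_ext _ _ fun x : T.V × U.V =>
            Prod.ext (T.act_mul g h x.1) (U.act_mul g h x.2) } }
  map {T T'} f := FinGSet.homMk (fun x : T.V × U.V => (f.hom x.1, x.2))
    fun g (x : T.V × U.V) => Prod.ext (FinGSet.hom_act f g x.1) rfl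

/-- The projection `T × U ⟶ T`. -/
def prodFinGSetFst : prodFinGSet U ⟶ 𝟭 (FinGSet G) where
  app T := FinGSet.homMk (fun x : T.V × U.V => x.1) fun _ _ => rfl

/-- The projection `S × U ⟶ S`. -/
def prodGSetFst : prodGSet U ⟶ 𝟭 (GSet G) where
  app S := GSet.homMk (fun x : S.V × U.V => x.1) fun _ _ => rfl

/-- The product of `U` with an orbit of `S`, as a subset of `S × U`. -/
def orbitProdInclusion {S : GSet G} (o : Orbits S) :
    toGSet.obj ((prodFinGSet U).obj (orbit o)) ⟶ (prodGSet U).obj S :=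
  GSet.homMk (fun x : OrbitElts o × U.V => (x.1.1, x.2)) fun _ _ => rfl

section ExtendedTransfer

variable [IsIso (extensionComparison F)]

theorem map_comp_inv_extensionComparison {T T' : FinGSet G} (g : T ⟶ T') :
    F.map g ≫ inv ((extensionComparison F).app T') =
      inv ((extensionComparison F).app T) ≫ (additiveExtension F).map (toGSet.map g) := by
  rw [IsIso.comp_inv_eq, Category.assoc, IsIso.eq_inv_comp]
  exact ((extensionComparison F).naturality g).symm

variable {U} (t : F ⟶ prodFinGSet U ⋙ F)

/-- The component of `extendedTransfer` on an orbit `o`: the transfer `F(o) ⟶ F(o × U)`, followed by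
the map induced by `o × U ⟶ S × U`. -/
noncomputable def orbitTransfer {S : GSet G} (o : Orbits S) :
    F.obj (orbit o) ⟶ (prodExtension U F).obj S :=
  t.app (orbit o) ≫ inv ((extensionComparison F).app ((prodFinGSet U).obj (orbit o))) ≫
    (additiveExtension F).map (orbitProdInclusion U o)

theorem orbitTransfer_map {S S' : GSet G} (f : S ⟶ S') (o : Orbits S) :
    F.map (orbitMap f o _ rfl) ≫ orbitTransfer t (mapOrbits f o) =
      orbitTransfer t o ≫ (prodExtension U F).map f := by
  let m := orbitMap f o _ rfl
  have h2 : toGSet.map ((prodFinGSet U).map m) ≫ orbitProdInclusion U (mapOrbits f o) =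
      orbitProdInclusion U o ≫ (prodGSet U).map f := GSet.hom_ext fun _ => rfl
  have h3 := map_comp_inv_extensionComparison (F := F) ((prodFinGSet U).map m)
  have h4 : F.map ((prodFinGSet U).map m) ≫
      inv ((extensionComparison F).app ((prodFinGSet U).obj (orbit (mapOrbits f o)))) ≫
        (additiveExtension F).map (orbitProdInclusion U (mapOrbits f o)) =
      inv ((extensionComparison F).app ((prodFinGSet U).obj (orbit o))) ≫
        (additiveExtension F).map (orbitProdInclusion U o) ≫
          (additiveExtension F).map ((prodGSet U).map f) := by
    rw [← Category.assoc, h3, Category.assoc, ← CategoryTheory.Functor.map_comp, h2,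
      CategoryTheory.Functor.map_comp]
  refine (Category.assoc _ _ _).symm.trans ((congrArg (· ≫ _) (t.naturality m)).trans ?_)
  refine (Category.assoc _ _ _).trans ((congrArg (t.app (orbit o) ≫ ·) h4).trans ?_)
  refine Eq.trans ?_ (Category.assoc _ _ _).symm
  exact congrArg (t.app (orbit o) ≫ ·) (Category.assoc _ _ _).symm

/-- The extension of a transfer `F(T) ⟶ F(T × U)` to all `G`-sets. -/
noncomputable def extendedTransfer : additiveExtension F ⟶ prodExtension U F where
  app S := extensionDesc fun o => orbitTransfer t o
  naturality {S S'} f := extension_hom_ext fun o => by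
    rw [← Category.assoc, extensionι_map f o _ rfl, Category.assoc, extensionι_desc,
      ← Category.assoc, extensionι_desc, orbitTransfer_map]

theorem orbitTransfer_fst {S : GSet G} (o : Orbits S) :
    orbitTransfer t o ≫ (additiveExtension F).map ((prodGSetFst U).app S) =
      (t.app (orbit o) ≫ F.map ((prodFinGSetFst U).app (orbit o))) ≫ extensionι F o := by
  have h2 : orbitProdInclusion U o ≫ (prodGSetFst U).app S =
      toGSet.map ((prodFinGSetFst U).app (orbit o)) ≫ orbitInclusion o :=
    GSet.hom_ext fun _ => rfl
  have h3 := (extensionComparison F).naturality ((prodFinGSetFst U).app (orbit o))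
  have h4 : inv ((extensionComparison F).app ((prodFinGSet U).obj (orbit o))) ≫
        (additiveExtension F).map (orbitProdInclusion U o) ≫
          (additiveExtension F).map ((prodGSetFst U).app S) =
      F.map ((prodFinGSetFst U).app (orbit o)) ≫ extensionι F o := by
    rw [IsIso.inv_comp_eq, ← CategoryTheory.Functor.map_comp, h2,
      CategoryTheory.Functor.map_comp]
    refine (congrArg (_ ≫ ·) (extensionComparison_orbit o).symm).trans ?_
    refine (Category.assoc _ _ _).symm.trans ((congrArg (· ≫ _) h3).trans ?_)
    exact Category.assoc _ _ _
  refine (Category.assoc _ _ _).trans ((congrArg (t.app (orbit o) ≫ ·) ?_).trans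
    (Category.assoc _ _ _).symm)
  exact (Category.assoc _ _ _).trans h4

/-- If the composite of the transfer and the projection is invertible on finite `G`-sets, then
`additiveExtension F` is a direct summand of `prodExtension U F`. -/
noncomputable def extensionRetract
    (ht : ∀ T, IsIso (t.app T ≫ F.map ((prodFinGSetFst U).app T))) :
    Retract (additiveExtension F) (prodExtension U F) :=
  let c : additiveExtension F ⟶ additiveExtension F :=
    extendedTransfer t ≫ Functor.whiskerRight (prodGSetFst U) (additiveExtension F)
  have hc (S : GSet G) (o : Orbits S) : extensionι F o ≫ c.app S =
      (t.app (orbit o) ≫ F.map ((prodFinGSetFst U).app (orbit o))) ≫ extensionι F o :=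
    (Category.assoc _ _ _).symm.trans
      ((congrArg (· ≫ _) (extensionι_desc _ _)).trans (orbitTransfer_fst t o))
  have : IsIso c := by
    have (S : GSet G) : IsIso (c.app S) := by
      refine ⟨extensionDesc fun o =>
        inv (t.app (orbit o) ≫ F.map ((prodFinGSetFst U).app (orbit o))) ≫ extensionι F o,
        extension_hom_ext fun o => ?_, extension_hom_ext fun o => ?_⟩
      · rw [← Category.assoc, hc, Category.assoc, extensionι_desc, IsIso.hom_inv_id_assoc,
          Category.comp_id]
      · rw [← Category.assoc, extensionι_desc, Category.assoc, hc, IsIso.inv_hom_id_assoc,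
          Category.comp_id]
    exact NatIso.isIso_of_isIso_app c
  { i := extendedTransfer t
    r := Functor.whiskerRight (prodGSetFst U) (additiveExtension F) ≫ inv c
    retract := (Category.assoc _ _ _).symm.trans (IsIso.hom_inv_id c) }

end ExtendedTransfer

end Transfer

/-! ### Chains of direct summands -/

section QuasiIso

open AlgebraicTopology

theorem isIso_map_of_retract {C : Type*} [Category C] {D : Type*} [Category D] {A B : C ⥤ D}
    (h : Retract A B) {X Y : C} (f : X ⟶ Y) [IsIso (B.map f)] : IsIso (A.map f) := by
  refine ⟨h.i.app Y ≫ inv (B.map f) ≫ h.r.app X, ?_, ?_⟩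
  · rw [h.i.naturality_assoc, IsIso.hom_inv_id_assoc, ← NatTrans.comp_app, h.retract,
      NatTrans.id_app]
  · rw [Category.assoc, Category.assoc, ← h.r.naturality, IsIso.inv_hom_id_assoc,
      ← NatTrans.comp_app, h.retract, NatTrans.id_app]

/-- The normalized and the alternating face map complex have the same homology. -/
theorem quasiIso_normalizedMooreComplex_map_iff {C : Type*} [Category C] [Abelian C]
    {A B : SimplicialObject C} (φ : A ⟶ B) :
    QuasiIso ((normalizedMooreComplex C).map φ) ↔
      QuasiIso ((alternatingFaceMapComplex C).map φ) := by
  have (X : SimplicialObject C) : QuasiIso ((inclusionOfMooreComplex C).app X) :=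
    (DoldKan.homotopyEquivNormalizedMooreComplexAlternatingFaceMapComplex (Y := X)).quasiIso_hom
  rw [← quasiIso_iff_comp_right _ ((inclusionOfMooreComplex C).app B),
    (inclusionOfMooreComplex C).naturality φ, quasiIso_iff_comp_left]

variable {G : Type u} [Group G] [Finite G]
variable {C : Type v} [Category.{u} C] [Abelian C] [HasCoproducts.{u} C] {F : FinGSet G ⥤ C}

/-- The homology of the chains with coefficients in `F` is a direct summand of the homology of the
chains with coefficients in `S ↦ F(S × U)`. -/
theorem quasiIso_normalizedChains [IsIso (extensionComparison F)] {U : FinGSet G}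
    (t : F ⟶ prodFinGSet U ⋙ F) (ht : ∀ T, IsIso (t.app T ≫ F.map ((prodFinGSetFst U).app T)))
    {p : ℕ} (hU : ∀ u : U.V, IsPGroup p (isotropy (toGSet.obj U) u)) {Y X : GSpace G} (f : Y ⟶ X)
    (hf : ∀ K : Subgroup G, IsPGroup p K → IsWeakEquivalence ((fixedPoints K).map f)) :
    QuasiIso ((normalizedChains F).map f) := by
  have h1 : QuasiIso (((SimplicialObject.whiskering _ _).obj
      (prodExtension U F) ⋙ alternatingFaceMapComplex C).map f) :=
    homotopyEquivalences_le_quasiIso _ _ _ (homotopyEquivalences_prodExtension hU f hf)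
  refine (quasiIso_normalizedMooreComplex_map_iff
    (((SimplicialObject.whiskering _ _).obj (additiveExtension F)).map f)).mpr ?_
  rw [quasiIso_iff]
  intro n
  rw [quasiIsoAt_iff_isIso_homologyMap]
  let L : (GSet G ⥤ C) ⥤ GSpace G ⥤ C := SimplicialObject.whiskering _ _ ⋙
    (Functor.whiskeringRight _ _ _).obj
      (alternatingFaceMapComplex C ⋙ HomologicalComplex.homologyFunctor _ _ n)
  have : IsIso ((L.obj (prodExtension U F)).map f) :=
    (quasiIsoAt_iff_isIso_homologyMap _ n).mp (h1.quasiIsoAt n)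
  exact isIso_map_of_retract ((extensionRetract t ht).map L) f

end QuasiIso

/-! ### Coproducts in categories of spans -/

section SpanClass

variable {C : Type v} [Category.{w} C]

theorem exists_spanClass {S T : C} (s : SpanClass S T) :
    ∃ (V : C) (l : V ⟶ S) (r : V ⟶ T), s = spanClass l r := by
  obtain ⟨s, rfl⟩ := Quotient.exists_rep s
  exact ⟨s.apex, s.l, s.r, rfl⟩

theorem exists_iso_of_spanClass_eq {S T V V' : C} {l : V ⟶ S} {r : V ⟶ T} {l' : V' ⟶ S}
    {r' : V' ⟶ T} (h : spanClass l r = spanClass l' r') :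
    ∃ e : V ≅ V', e.hom ≫ l' = l ∧ e.hom ≫ r' = r := by
  obtain ⟨e⟩ := Quotient.exact h
  exact ⟨⟨e.hom.hom, e.inv.hom, congrArg Span.Hom.hom e.hom_inv_id,
    congrArg Span.Hom.hom e.inv_hom_id⟩, e.hom.hom_l, e.hom.hom_r⟩

variable [FinitaryExtensive C]

/-- Finite coproducts of an extensive category are van Kampen colimits. -/
theorem nonempty_isColimit_cofan_iff {ι : Type*} [Finite ι] {X : ι → C} {c : Cofan X}
    (hc : IsColimit c) {Y : ι → C} (d : Cofan Y) (α : ∀ i, Y i ⟶ X i)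
    (f : d.pt ⟶ c.pt) (h : ∀ i, α i ≫ c.inj i = d.inj i ≫ f) :
    Nonempty (IsColimit d) ↔ ∀ i, IsPullback (d.inj i) (α i) f (c.inj i) :=
  (FinitaryExtensive.isVanKampen_finiteCoproducts hc d (Discrete.natTrans fun i => α i.as) f
    (by ext ⟨i⟩; exact h i) (.of_discrete _)).trans
    ⟨fun h i => h ⟨i⟩, fun h i => h i.as⟩

variable [HasPullbacks C]

/-- Spans out of the summands of a coproduct extend to the coproduct, with the coproduct of the
apices as apex. -/
theorem exists_comp_eq {ι : Type*} [Finite ι] {X : ι → C} {c : Cofan X}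
    (hc : IsColimit c) {R : C} (s : ∀ i, SpanClass (X i) R) :
    ∃ m : SpanClass c.pt R, ∀ i, (spanClass (𝟙 _) (c.inj i)).comp m = s i := by
  choose V l r hs using fun i => exists_spanClass (s i)
  refine ⟨spanClass (Sigma.desc fun i => l i ≫ c.inj i) (Sigma.desc r), fun i => ?_⟩
  have h := (nonempty_isColimit_cofan_iff hc (Cofan.mk (∐ V) (Sigma.ι V)) l
    (Sigma.desc fun i => l i ≫ c.inj i)
    (fun i => (Sigma.ι_desc (fun i => l i ≫ c.inj i) i).symm)).mp
      ⟨coproductIsCoproduct V⟩ i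
  rw [SpanClass.comp_eq_of_isPullback h.flip, hs]
  exact spanClass_eq (Iso.refl _) (by simp) (by simp)

/-- A span out of a coproduct is determined by its restrictions to the summands, because its apex is
the coproduct of the apices of these restrictions. -/
theorem eq_of_comp_eq {ι : Type*} [Finite ι] {X : ι → C} {c : Cofan X}
    (hc : IsColimit c) {R : C} {m m' : SpanClass c.pt R}
    (h : ∀ i, (spanClass (𝟙 _) (c.inj i)).comp m = (spanClass (𝟙 _) (c.inj i)).comp m') :
    m = m' := by
  obtain ⟨W, l, r, rfl⟩ := exists_spanClass m
  obtain ⟨W', l', r', rfl⟩ := exists_spanClass m'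
  simp only [SpanClass.comp_spanClass] at h
  choose e hl hr using fun i => exists_iso_of_spanClass_eq (h i)
  simp only [Category.comp_id] at hl
  have H (i) := IsPullback.of_hasPullback (c.inj i) l
  have H' (i) := IsPullback.of_hasPullback (c.inj i) l'
  let d : Cofan fun i => pullback (c.inj i) l := Cofan.mk W fun i => pullback.snd (c.inj i) l
  let d' : Cofan fun i => pullback (c.inj i) l :=
    Cofan.mk W' fun i => (e i).hom ≫ pullback.snd (c.inj i) l'
  obtain ⟨hd⟩ := (nonempty_isColimit_cofan_iff hc d (fun i => pullback.fst (c.inj i) l) l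
    fun i => (H i).w).mpr fun i => (H i).flip
  have H'' (i) : IsPullback (d'.inj i) (pullback.fst (c.inj i) l) l' (c.inj i) :=
    (H' i).flip.of_iso (e i).symm (Iso.refl _) (Iso.refl _) (Iso.refl _)
      (by simp [d']) (by simp [← hl]) (by simp) (by simp)
  obtain ⟨hd'⟩ := (nonempty_isColimit_cofan_iff hc d' (fun i => pullback.fst (c.inj i) l) l'
    fun i => (H'' i).w.symm).mpr H''
  have hdesc (i) : d.inj i ≫ (hd.coconePointUniqueUpToIso hd').hom = d'.inj i :=
    hd.comp_coconePointUniqueUpToIso_hom hd' ⟨i⟩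
  refine spanClass_eq (hd.coconePointUniqueUpToIso hd') ?_ ?_
  · refine Cofan.IsColimit.hom_ext hd _ _ fun i => ?_
    rw [← Category.assoc, hdesc]
    exact ((H'' i).w).trans (H i).w
  · refine Cofan.IsColimit.hom_ext hd _ _ fun i => ?_
    rw [← Category.assoc, hdesc]
    exact (Category.assoc _ _ _).trans (hr i)

/-- Finite coproducts of an extensive category remain coproducts in its category of spans. -/
noncomputable def isColimitCovariantCofan {ι : Type*} [Finite ι] {X : ι → C} {c : Cofan X}
    (hc : IsColimit c) :
    IsColimit (Cofan.mk ((SpanCat.covariant C).obj c.pt) fun i =>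
      (SpanCat.covariant C).map (c.inj i)) :=
  Cofan.IsColimit.mk _ (fun s => (exists_comp_eq hc fun i => s.inj i).choose)
    (fun s => (exists_comp_eq hc fun i => s.inj i).choose_spec)
    fun s _ hm => eq_of_comp_eq hc fun i => (hm i).trans
      ((exists_comp_eq hc fun i => s.inj i).choose_spec i).symm

variable {D : Type*} [Category D] (Γ : SpanCat C ⥤ D) [PreservesFiniteCoproducts Γ]

/-- The covariant functor underlying a functor on spans preserves finite coproducts if the latter
does so. -/
noncomputable def isColimitMapCovariantCofan {ι : Type*} [Finite ι] {X : ι → C} {c : Cofan X}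
    (hc : IsColimit c) :
    IsColimit (Cofan.mk ((SpanCat.covariant C ⋙ Γ).obj c.pt) fun i =>
      (SpanCat.covariant C ⋙ Γ).map (c.inj i)) :=
  isColimitCofanMkObjOfIsColimit Γ _ _ (isColimitCovariantCofan hc)

variable [Preadditive D]

theorem isZero_map_initial : IsZero (Γ.obj ⟨⊥_ C⟩) := by
  let c : Cofan fun x : PEmpty => (x.elim : C) := Cofan.mk (⊥_ C) fun x => x.elim
  have hc : IsColimit c := Cofan.IsColimit.mk _ (fun s => initial.to _) (fun _ x => x.elim)
    fun _ _ _ => initial.hom_ext _ _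
  rw [IsZero.iff_id_eq_zero]
  exact Cofan.IsColimit.hom_ext (isColimitMapCovariantCofan Γ hc) _ _ fun x => x.elim

/-- Finite coproducts become products under the contravariant functor underlying an additive functor
on the category of spans: the induced maps and the transfers form a biproduct. -/
theorem nonempty_isLimit_contravariant_fan {ι : Type*} [Finite ι] {X : ι → C} {c : Cofan X}
    (hc : IsColimit c) :
    Nonempty (IsLimit (Fan.mk ((SpanCat.contravariant C ⋙ Γ).obj (op c.pt)) fun i =>
      (SpanCat.contravariant C ⋙ Γ).map (c.inj i).op)) := by
  classical
  have := Fintype.ofFinite ι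
  let b : Bicone fun i => Γ.obj ⟨X i⟩ :=
    { pt := Γ.obj ⟨c.pt⟩
      ι i := (SpanCat.covariant C ⋙ Γ).map (c.inj i)
      π i := (SpanCat.contravariant C ⋙ Γ).map (c.inj i).op
      ι_π i j := by
        refine (Γ.map_comp _ _).symm.trans ?_
        split_ifs with h
        · subst h
          have : Mono (c.inj i) := FinitaryExtensive.mono_ι hc ⟨i⟩
          refine (congrArg Γ.map ?_).trans (Γ.map_id _)
          exact (SpanClass.comp_eq_of_isPullback (IsKernelPair.id_of_mono (c.inj i))).trans
            (spanClass_eq (Iso.refl _) ((Category.id_comp _).trans (Category.id_comp _).symm)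
              ((Category.id_comp _).trans (Category.id_comp _).symm))
        -- Distinct summands are disjoint, and the value at the empty set vanishes.
        · have hp := FinitaryExtensive.isPullback_initial_to hc ⟨i⟩ ⟨j⟩
            fun e => h (congrArg Discrete.as e)
          let a : (⟨X i⟩ : SpanCat C) ⟶ ⟨⊥_ C⟩ := spanClass (initial.to _) (𝟙 _)
          let a' : (⟨⊥_ C⟩ : SpanCat C) ⟶ ⟨X j⟩ := spanClass (𝟙 _) (initial.to _)
          have e : (SpanCat.covariant C).map (c.inj i) ≫
              (SpanCat.contravariant C).map (c.inj j).op = a ≫ a' := by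
            refine (SpanClass.comp_eq_of_isPullback hp).trans (Eq.symm ?_)
            refine (SpanClass.comp_eq_of_isPullback (IsPullback.of_id_fst)).trans ?_
            exact spanClass_eq (Iso.refl _) (initial.hom_ext _ _) (initial.hom_ext _ _)
          refine (congrArg Γ.map e).trans ((Γ.map_comp _ _).trans ?_)
          exact (congrArg (· ≫ _) ((isZero_map_initial Γ).eq_of_tgt _ 0)).trans zero_comp }
  have hb : IsColimit b.toCocone :=
    IsColimit.ofIsoColimit (isColimitMapCovariantCofan Γ hc)
      (Cofan.ext (Iso.refl _) fun i => Category.comp_id _)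
  exact ⟨IsLimit.ofIsoLimit (isBilimitOfIsColimit b hb).isLimit
    (Fan.ext (Iso.refl _) fun i => (Category.id_comp _).symm)⟩

end SpanClass

/-! ### Decomposition of finite `G`-sets into orbits -/

section Comparison

variable {G : Type u} [Group G]

instance : FinitaryExtensive (FinGSet G) :=
  finitaryExtensive_of_preserves_and_reflects_isomorphism
    (Action.forget FintypeCat.{u} G ⋙ FintypeCat.incl)

theorem rho_mem_orbit {T : FinGSet G} (g : G) (x : T.V) :
    (Quotient.mk (orbitSetoid (toGSet.obj T)) (T.act g x)) = Quotient.mk _ x :=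
  mk_rho (toGSet.obj T) g x

variable [Finite G]

/-- A finite `G`-set is the coproduct of its orbits. -/
noncomputable def isColimitOrbitCofan (T : FinGSet G) :
    IsColimit (Cofan.mk T fun o : Orbits (toGSet.obj T) => finOrbitInclusion o) :=
  Cofan.IsColimit.mk _
    (fun s => FinGSet.homMk (fun x : T.V => (s.inj (Quotient.mk _ x)).hom
        (⟨x, rfl⟩ : OrbitElts (S := toGSet.obj T) _)) fun g x => by
      have key (o o' : Orbits (toGSet.obj T)) (h : o = o') (y : OrbitElts o) (y' : OrbitElts o')
          (hy : y.1 = y'.1) : (s.inj o).hom y = (s.inj o').hom y' := by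
        subst h
        rw [Subtype.ext hy]
      exact (key _ _ (rho_mem_orbit g x) _ _ rfl).trans (FinGSet.hom_act (s.inj _) g _))
    (fun s o => FinGSet.hom_ext fun x : OrbitElts o => by
      obtain ⟨x, rfl⟩ := x
      rfl)
    fun s m hm => FinGSet.hom_ext fun x => by
      exact ConcreteCategory.congr_hom (congrArg Action.Hom.hom (hm (Quotient.mk _ x)))
        (⟨x, rfl⟩ : OrbitElts (S := toGSet.obj T) _)

variable {C : Type v} [Category.{u} C] [HasCoproducts.{u} C] {F : FinGSet G ⥤ C}

theorem isIso_extensionComparison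
    (h : ∀ T, Nonempty (IsColimit (Cofan.mk (F.obj T)
      fun o : Orbits (toGSet.obj T) => F.map (finOrbitInclusion o)))) :
    IsIso (extensionComparison F) := by
  have (T : FinGSet G) : IsIso ((extensionComparison F).app T) := by
    obtain ⟨hT⟩ := h T
    refine ⟨Cofan.IsColimit.desc hT fun o => extensionι F o, extension_hom_ext fun o => ?_,
      Cofan.IsColimit.hom_ext hT _ _ fun o => ?_⟩
    · refine (Category.assoc _ _ _).symm.trans
        ((congrArg (· ≫ _) (extensionι_desc _ _)).trans ?_)
      exact (Cofan.IsColimit.fac hT _ o).trans (Category.comp_id _).symm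
    · rw [← Category.assoc, Cofan.IsColimit.fac]
      exact (extensionι_desc _ _).trans (Category.comp_id _).symm
  exact NatIso.isIso_of_isIso_app _

end Comparison

/-! ### The transfers of a Mackey functor -/

section MackeyTransfer

variable {G : Type u} [Group G]

/-- The square with rows `T × U ⟶ T' × U` and `T ⟶ T'` is cartesian. -/
theorem isPullback_prodFinGSet (U : FinGSet G) {T T' : FinGSet G} (f : T ⟶ T') :
    IsPullback ((prodFinGSet U).map f) ((prodFinGSetFst U).app T) ((prodFinGSetFst U).app T') f :=
  .of_isLimit' ⟨FinGSet.hom_ext fun _ => rfl⟩ <| PullbackCone.IsLimit.mk _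
    (fun s => FinGSet.homMk
      (fun x : s.pt.V => ((s.snd.hom x, (show T'.V × U.V from s.fst.hom x).2) : T.V × U.V))
      fun g x => Prod.ext (FinGSet.hom_act s.snd g x)
        (congrArg (Prod.snd (α := T'.V) (β := U.V)) (FinGSet.hom_act s.fst g x)))
    (fun s => FinGSet.hom_ext fun x => Prod.ext
      (ConcreteCategory.congr_hom (congrArg Action.Hom.hom s.condition) x).symm rfl)
    (fun _ => FinGSet.hom_ext fun _ => rfl)
    fun _ _ h1 h2 => FinGSet.hom_ext fun x => Prod.ext
      (ConcreteCategory.congr_hom (congrArg Action.Hom.hom h2) x)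
      (congrArg (Prod.snd (α := T'.V) (β := U.V))
        (ConcreteCategory.congr_hom (congrArg Action.Hom.hom h1) x))

theorem natCard_fibre_prodFinGSetFst (U T : FinGSet G) (t : T.V) :
    Nat.card {s : ((prodFinGSet U).obj T).V // ((prodFinGSetFst U).app T).hom s = t} =
      Nat.card U.V :=
  Nat.card_congr
    { toFun s := (show T.V × U.V from s.1).2
      invFun x := ⟨((t, x) : T.V × U.V), rfl⟩
      left_inv := fun ⟨_, hs⟩ => Subtype.ext (Prod.ext (α := T.V) (β := U.V) hs.symm rfl)
      right_inv _ := rfl }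

theorem contravariant_comp_covariant {C : Type v} [Category.{w} C] [HasPullbacks C] {S T V : C}
    (l : V ⟶ S) (r : V ⟶ T) :
    (SpanCat.contravariant C).map l.op ≫ (SpanCat.covariant C).map r = spanClass l r :=
  (SpanClass.comp_eq_of_isPullback (IsPullback.of_id_fst)).trans
    (spanClass_eq (Iso.refl _) rfl rfl)

theorem covariant_comp_contravariant {C : Type v} [Category.{w} C] [HasPullbacks C]
    {S T V P : C} {f : S ⟶ V} {g : T ⟶ V} {p : P ⟶ S} {q : P ⟶ T} (h : IsPullback p q f g) :
    (SpanCat.covariant C).map f ≫ (SpanCat.contravariant C).map g.op = spanClass p q :=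
  (SpanClass.comp_eq_of_isPullback h).trans (spanClass_eq (Iso.refl _)
    ((Category.id_comp _).trans (Category.comp_id _).symm)
    ((Category.id_comp _).trans (Category.comp_id _).symm))

namespace MackeyFunctor

variable (Γ : MackeyFunctor G)

/-- The Mackey double coset formula, for a cartesian square. -/
theorem cov_comp_contra {S T V P : FinGSet G} {f : S ⟶ V} {g : T ⟶ V} {p : P ⟶ S} {q : P ⟶ T}
    (h : IsPullback p q f g) :
    Γ.cov.map f ≫ Γ.contra.map g.op = Γ.contra.map p.op ≫ Γ.cov.map q := by
  refine (Γ.functor.map_comp _ _).symm.trans (Eq.trans ?_ (Γ.functor.map_comp _ _))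
  exact congrArg Γ.functor.map
    ((covariant_comp_contravariant h).trans (contravariant_comp_covariant p q).symm)

/-- The transfers `Γ(T) ⟶ Γ(T × U)`. They are natural by the double coset formula. -/
noncomputable def covTransfer (U : FinGSet G) : Γ.cov ⟶ prodFinGSet U ⋙ Γ.cov where
  app T := Γ.contra.map ((prodFinGSetFst U).app T).op
  naturality _ _ f := Γ.cov_comp_contra (isPullback_prodFinGSet U f).flip

/-- The maps `Γ(T × U) ⟶ Γ(T)` induced by the projections, which are natural with respect to
transfers by the double coset formula. In the opposite category they play the part of the
transfers. -/
noncomputable def contraTransfer (U : FinGSet G) :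
    Γ.contra.rightOp ⟶ prodFinGSet U ⋙ Γ.contra.rightOp where
  app T := (Γ.cov.map ((prodFinGSetFst U).app T)).op
  naturality _ _ f := congrArg Quiver.Hom.op (Γ.cov_comp_contra (isPullback_prodFinGSet U f))

variable {Γ}

/-- The composite `Γ(T) ⟶ Γ(T × U) ⟶ Γ(T)` is given by the span `T ⟵ T × U ⟶ T`, and the fibres of
`T × U ⟶ T` are copies of `U`. -/
theorem IsPConstrained.isIso_contra_comp_cov {p : ℕ} (hΓ : Γ.IsPConstrained p) {U : FinGSet G}
    (hU : (Nat.card U.V).Coprime p) (T : FinGSet G) :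
    IsIso (Γ.contra.map ((prodFinGSetFst U).app T).op ≫
      Γ.cov.map ((prodFinGSetFst U).app T)) := by
  have h := hΓ ((prodFinGSetFst U).app T) fun t => by
    refine Eq.mpr (congrArg (Nat.Coprime · p) (natCard_fibre_prodFinGSetFst U T t)) hU
  have e : Γ.contra.map ((prodFinGSetFst U).app T).op ≫ Γ.cov.map ((prodFinGSetFst U).app T) =
      Γ.functor.map (X := ⟨T⟩) (Y := ⟨T⟩)
        (spanClass ((prodFinGSetFst U).app T) ((prodFinGSetFst U).app T)) :=
    (Γ.functor.map_comp _ _).symm.trans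
      (congrArg Γ.functor.map (contravariant_comp_covariant _ _))
  rw [e]
  exact h

end MackeyFunctor

instance (T : FinGSet G) : Finite (Orbits (toGSet.obj T)) :=
  have : Finite (toGSet.obj T).V := inferInstanceAs (Finite T.V)
  Quotient.finite _

variable [Finite G] (Γ : MackeyFunctor G)

instance : IsIso (extensionComparison Γ.cov) :=
  have := Γ.additive
  isIso_extensionComparison fun T =>
    ⟨isColimitMapCovariantCofan Γ.functor (isColimitOrbitCofan T)⟩

instance : IsIso (extensionComparison Γ.contra.rightOp) :=
  have := Γ.additive
  isIso_extensionComparison fun T => by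
    obtain ⟨h⟩ := nonempty_isLimit_contravariant_fan Γ.functor (isColimitOrbitCofan T)
    exact ⟨Cofan.IsColimit.mk _ (fun s => (Fan.IsLimit.lift h fun o => (s.inj o).unop).op)
      (fun s o => Quiver.Hom.unop_inj (Fan.IsLimit.fac h (fun o => (s.inj o).unop) o))
      fun s m hm => Quiver.Hom.unop_inj (Fan.IsLimit.hom_ext h _ _ fun o =>
        (congrArg Quiver.Hom.unop (hm o)).trans
          (Fan.IsLimit.fac h (fun o => (s.inj o).unop) o).symm)⟩

end MackeyTransfer

/-! ### Approximations with respect to the `p`-subgroups -/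

section Sylow

variable {G : Type u} [Group G] [Finite G]

/-- For a prime `p` there is a finite `G`-set of cardinality prime to `p` whose isotropy groups are
`p`-groups: the quotient of `G` by a Sylow `p`-subgroup. -/
theorem exists_coprime_isPGroup {p : ℕ} (hp : p.Prime) :
    ∃ U : FinGSet G, (Nat.card U.V).Coprime p ∧
      ∀ u : U.V, IsPGroup p (isotropy (toGSet.obj U) u) := by
  have := Fact.mk hp
  obtain ⟨P⟩ : Nonempty (Sylow p G) := inferInstance
  let V : FintypeCat.{u} := ⟨G ⧸ (P : Subgroup G), inferInstance⟩
  let _ : MulAction G V := inferInstanceAs (MulAction G (G ⧸ (P : Subgroup G)))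
  refine ⟨Action.FintypeCat.ofMulAction G V, ?_, fun u => ?_⟩
  · exact ((Nat.Prime.coprime_iff_not_dvd hp).2 P.not_dvd_index).symm
  · obtain ⟨g, rfl⟩ := QuotientGroup.mk_surjective (s := (P : Subgroup G)) u
    have h : isotropy (toGSet.obj (Action.FintypeCat.ofMulAction G V)) (g : G ⧸ (P : Subgroup G)) =
        MulAction.stabilizer G (g • ((1 : G) : G ⧸ (P : Subgroup G))) := by
      rw [MulAction.Quotient.smul_coe, smul_eq_mul, mul_one]
      rfl
    rw [h, MulAction.stabilizer_smul_eq_stabilizer_map_conj, MulAction.stabilizer_quotient]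
    exact P.isPGroup'.map _

end Sylow

section Approximations

variable {G : Type u} [Group G] [Finite G] {p : ℕ} {Γ : MackeyFunctor G}

/-- Only the condition on fixed points matters: both coefficient systems of a `p`-constrained Mackey
functor are direct summands of their products with `U = G / P`, where `P` is a Sylow `p`-subgroup.
For cochains, the argument takes place in the opposite of the category of abelian groups. -/
theorem quasiIso_bredonChains_and_bredonCochains (hp : p.Prime) (hΓ : Γ.IsPConstrained p)
    {Y X : GSpace G} (f : Y ⟶ X)
    (hf : ∀ K : Subgroup G, IsPGroup p K → IsWeakEquivalence ((fixedPoints K).map f)) :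
    QuasiIso ((bredonChains Γ.cov).map f) ∧ QuasiIso ((bredonCochains Γ.contra).map f.op) := by
  obtain ⟨U, hcard, hU⟩ := exists_coprime_isPGroup (G := G) hp
  have ht := hΓ.isIso_contra_comp_cov hcard
  refine ⟨quasiIso_normalizedChains (Γ.covTransfer U) ht hU f hf,
    (HomologicalComplex.quasiIso_unopFunctor_map_iff _).mpr
      (quasiIso_normalizedChains (Γ.contraTransfer U) (fun T => ?_) hU f hf)⟩
  have := ht T
  exact inferInstanceAs (IsIso (Γ.contra.map ((prodFinGSetFst U).app T).op ≫
    Γ.cov.map ((prodFinGSetFst U).app T)).op)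

end Approximations

end Bredon

theorem proposition4p6 {G : Type u} [Group G] [Finite G] {p : ℕ} (hp : p.Prime)
    (Γ : Bredon.MackeyFunctor G) (hΓ : Γ.IsPConstrained p)
    {XA X : Bredon.GSpace G} (f : XA ⟶ X)
    (hf : Bredon.IsApproximation (Bredon.allPSubgroups G p) f) (n : ℕ) :
    IsIso ((Bredon.bredonHomology Γ n).map f) ∧
      IsIso ((Bredon.bredonCohomology Γ n).map f.op) := by
  obtain ⟨h1, h2⟩ := Bredon.quasiIso_bredonChains_and_bredonCochains hp hΓ f hf.equivalence
  exact ⟨(quasiIsoAt_iff_isIso_homologyMap _ n).mp (h1.quasiIsoAt n),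
    (quasiIsoAt_iff_isIso_homologyMap _ n).mp (h2.quasiIsoAt n)⟩
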